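/- Let $\mathcal{S}$ be a subset of a Euclidean space, $\mathcal{A}$ a compact subset of a Euclidean space, $Z=\mathcal{S}\times\mathcal{A}$, and let $\mathcal{P}(Z)$ be the set of Borel probability measures on $Z$. Let $k:Z\times Z\to\mathbb{R}$ be a continuous symmetric positive semidefinite kernel with $\sup_{z\in Z}k(z,z)\le 1$, and let $\mathcal{H}_k$ be its reproducing kernel Hilbert space, with norm $\|\cdot\|_k$. For $\epsilon>0$ and $\nu\in\mathcal{P}(Z)$ put $$\mathcal{R}(\mathcal{P}(Z),\mathcal{H}_k,\epsilon,\nu)=\sup\Big\{\sup_{\rho\in\mathcal{P}(Z)}\Big|\int_Z g\,d\rho\Big| \;:\; g\in\mathcal{H}_k,\ \|g\|_k\le 1,\ \|g\|_{L^2(\nu)}\le\epsilon\Big\}.$$ For $\nu\in\mathcal{P}(Z)$ let $\Lambda_1^\nu\ge\Lambda_2^\nu\ge\dots\ge 0$ be the eigenvalues of $(\mathcal{K}_\nu g)(z)=\int_Z k(z,z')g(z')\,d\nu(z')$ on $L^2(\nu)$ in nonincreasing order, counted with multiplicity and with $\Lambda_i^\nu=0$ if there are fewer than $i$ positive eigenvalues.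 For a positive integer $n$ put $n(\nu)=\max\{i\in\mathbb{N}^+: n\Lambda_i^\nu\ge 1\}$, with $n(\nu)=0$ if there is no such $i$. Then for every positive integer $n$ the following hold. 1. For every $\nu\in\mathcal{P}(Z)$, the number $n(\nu)$ is well defined and $n(\nu)\le n$. 2. For every $\nu\in\mathcal{P}(Z)$, $$\mathcal{R}(\mathcal{P}(Z),\mathcal{H}_k,n^{-1/2},\nu)\ \ge\ \frac12\sqrt{\sup_{\rho\in\mathcal{P}(Z)}\sum_{i=n(\nu)+1}^{\infty}\Lambda_i^\rho}\,.$$ 3. Consequently, $$\inf_{\nu\in\mathcal{P}(Z)}\mathcal{R}(\mathcal{P}(Z),\mathcal{H}_k,n^{-1/2},\nu)\ \ge\ \frac12\sqrt{\sup_{\rho\in\mathcal{P}(Z)}\sum_{i=n+1}^{\infty}\Lambda_i^\rho}\,.$$ 4. Let $\hat\nu\in\mathcal{P}(Z)$ be such that no non-zero function of $\mathcal{H}_k$ vanishes $\hat\nu$-almost everywhere (for instance, a measure with full support; the condition is equivalent to the validity of the Mercer decomposition $k(z,z')=\sum_i\Lambda_i^{\hat\nu}\psi_i^{\hat\nu}(z)\psi_i^{\hat\nu}(z')$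 at all $z,z'\in Z$). Let $\psi_i^{\hat\nu}$, for the indices $i$ with $\Lambda_i^{\hat\nu}>0$, be eigenfunctions of $\mathcal{K}_{\hat\nu}$ that are orthonormal in $L^2(\hat\nu)$ and satisfy $\int_Z k(z,z')\psi_i^{\hat\nu}(z')\,d\hat\nu(z')=\Lambda_i^{\hat\nu}\psi_i^{\hat\nu}(z)$ for every $z\in Z$. Put $C=\sup_{i:\Lambda_i^{\hat\nu}>0}\ \sup_{z\in Z}|\psi_i^{\hat\nu}(z)|$ (with $C=0$ if there is no such $i$). If $C<\infty$, then $$\mathcal{R}(\mathcal{P}(Z),\mathcal{H}_k,n^{-1/2},\hat\nu)\ \le\ 2\,C\,\sqrt{\frac{n(\hat\nu)}{n}+\sum_{i=n(\hat\nu)+1}^{\infty}\Lambda_i^{\hat\nu}}\,.$$ -/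

import Mathlib

open MeasureTheory
open scoped ENNReal

/-- A continuous (symmetric) positive semidefinite kernel `k : Z × Z → ℝ`. -/
structure PDKernel (Z : Type*) [TopologicalSpace Z] where
  toFun : Z → Z → ℝ
  continuous_toFun : Continuous (Function.uncurry toFun)
  symm : ∀ z z', toFun z z' = toFun z' z
  nonneg : ∀ (m : ℕ) (z : Fin m → Z) (c : Fin m → ℝ),
    0 ≤ ∑ i, ∑ j, c i * c j * toFun (z i) (z j)

namespace PDKernel

variable {Z : Type*} [TopologicalSpace Z]

instance : CoeFun (PDKernel Z) (fun _ => Z → Z → ℝ) := ⟨PDKernel.toFun⟩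

/-- The kernel as an operator-valued matrix: the entry at `(z, z')` is multiplication by
`k z z'` on `ℝ`. -/
noncomputable def toMatrix (k : PDKernel Z) : Matrix Z Z (ℝ →L[ℝ] ℝ) :=
  Matrix.of fun z z' => k z z' • ContinuousLinearMap.id ℝ ℝ

@[simp]
theorem toMatrix_apply (k : PDKernel Z) (z z' : Z) (c : ℝ) : k.toMatrix z z' c = k z z' * c := by
  change (k z z' • ContinuousLinearMap.id ℝ ℝ) c = _
  simp

theorem toMatrix_posSemidef (k : PDKernel Z) : k.toMatrix.PosSemidef := by
  refine ((RKHS.posSemidef_tfae (K := k.toMatrix)).out 0 2 rfl rfl).mpr ⟨?_, ?_⟩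
  · ext x y
    have h : star (k.toMatrix y x) = k.toMatrix x y := by
      rw [ContinuousLinearMap.star_eq_adjoint]
      refine ((ContinuousLinearMap.eq_adjoint_iff _ _).mpr fun a b => ?_).symm
      simp [k.symm x y]
      ring
    rw [Matrix.conjTranspose_apply, h]
  · intro v
    classical
    have h := k.nonneg v.support.card (fun i => (v.support.equivFin.symm i : Z))
      (fun i => v (v.support.equivFin.symm i : Z))
    have e : ∀ F : Z → ℝ, ∑ i : Fin v.support.card, F (v.support.equivFin.symm i : Z)
        = ∑ x ∈ v.support, F x := fun F => by
      rw [Equiv.sum_comp v.support.equivFin.symm (fun x => F (x : Z))]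
      exact Finset.sum_coe_sort v.support F
    have h' : 0 ≤ ∑ x ∈ v.support, ∑ y ∈ v.support, v x * v y * k x y := by
      refine h.trans_eq ?_
      rw [← e (fun x => ∑ y ∈ v.support, v x * v y * k x y)]
      exact Finset.sum_congr rfl fun i _ =>
        e (fun y => v (v.support.equivFin.symm i : Z) * v y * k (v.support.equivFin.symm i : Z) y)
    refine le_of_le_of_eq h' ?_
    have key : ∀ x y, inner ℝ (k.toMatrix y x (v x)) (v y) = v x * v y * k x y := by
      intro x y
      simp [k.symm x y]
      ring
    exact Finset.sum_congr rfl fun x _ => Finset.sum_congr rfl fun y _ => (key x y).symm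

instance (k : PDKernel Z) : Fact k.toMatrix.PosSemidef := ⟨k.toMatrix_posSemidef⟩

/-- The reproducing kernel Hilbert space `H_k` with reproducing kernel `k`. -/
abbrev Hk (k : PDKernel Z) := RKHS.OfKernel k.toMatrix

/-- The value at `z` of a function of `H_k` is its inner product with `k(z, ·)`, and
`k(z, ·)`, which is `RKHS.kerFun k.Hk z 1`, takes the value `k z z'` at `z'`. -/
theorem reproducing (k : PDKernel Z) (z : Z) :
    (∀ g : k.Hk, g z = inner ℝ g (RKHS.kerFun k.Hk z 1)) ∧
      ∀ z', RKHS.kerFun k.Hk z 1 z' = k z z' := by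
  refine ⟨fun g => by simp, fun z' => ?_⟩
  rw [RKHS.kerFun_apply, RKHS.OfKernel.kernel_ofKernel]
  simp [k.symm z z']

end PDKernel

section Response

variable {Z : Type*} [MeasurableSpace Z]

/-- The semi-norm `‖g‖_Π = sup_{ρ ∈ Π} |∫ g dρ|`. -/
noncomputable def piNorm (P : Set (ProbabilityMeasure Z)) (g : Z → ℝ) : ℝ≥0∞ :=
  ⨆ ρ ∈ P, ‖∫ z, g z ∂(ρ : Measure Z)‖ₑ

/-- The `ν`-perturbation space with scale `ε` of a normed space `B` of functions on `Z`:
all `g ∈ B` with `‖g‖_B ≤ 1` and `‖g‖_{L²(ν)} ≤ ε`. -/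
def perturbationSpace (B : Type*) [NormedAddCommGroup B] [FunLike B Z ℝ]
    (ε : ℝ) (ν : ProbabilityMeasure Z) : Set B :=
  {g | ‖g‖ ≤ 1 ∧ eLpNorm (g : Z → ℝ) 2 (ν : Measure Z) ≤ ENNReal.ofReal ε}

/-- The perturbation response by distribution mismatch `R(Π, B, ε, ν)`. -/
noncomputable def perturbationResponse (P : Set (ProbabilityMeasure Z))
    (B : Type*) [NormedAddCommGroup B] [FunLike B Z ℝ]
    (ε : ℝ) (ν : ProbabilityMeasure Z) : ℝ≥0∞ :=
  ⨆ g ∈ perturbationSpace B ε ν, piNorm P (g : Z → ℝ)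

end Response

section Spectrum

variable {Z : Type*} [MeasurableSpace Z]

/-- `f ∈ L²(ν)` satisfies `K_ν f = μ f` in `L²(ν)`, where
`(K_ν f)(z) = ∫ k(z, z') f(z') dν(z')`. -/
def IsKernelEigenvector (k : Z → Z → ℝ) (ν : ProbabilityMeasure Z) (μ : ℝ)
    (f : Lp ℝ 2 (ν : Measure Z)) : Prop :=
  (fun z => ∫ z', k z z' * f z' ∂(ν : Measure Z)) =ᵐ[(ν : Measure Z)] fun z => μ * f z

/-- For `i ≥ 1`, the `i`-th largest eigenvalue `Λ_i^ν` of `K_ν` on `L²(ν)`, counted with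
multiplicity: the largest `t > 0` such that the eigenvectors with eigenvalue at least `t` span a
space of dimension at least `i`. It is `0` if `K_ν` has fewer than `i` positive eigenvalues. -/
noncomputable def kernelEigenvalue (k : Z → Z → ℝ) (ν : ProbabilityMeasure Z) (i : ℕ) : ℝ :=
  sSup {t : ℝ | 0 < t ∧ (i : Cardinal) ≤ Module.rank ℝ
    (Submodule.span ℝ {f | ∃ μ : ℝ, t ≤ μ ∧ IsKernelEigenvector k ν μ f})}

/-- The set `{i ≥ 1 : n Λ_i^ν ≥ 1}`. -/
def largeIndices (k : Z → Z → ℝ) (n : ℕ) (ν : ProbabilityMeasure Z) : Set ℕ :=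
  {i | 1 ≤ i ∧ 1 ≤ n * kernelEigenvalue k ν i}

/-- `n(ν) = max {i ≥ 1 : n Λ_i^ν ≥ 1}`, with value `0` if there is no such `i`. -/
noncomputable def effectiveIndex (k : Z → Z → ℝ) (n : ℕ) (ν : ProbabilityMeasure Z) : ℕ :=
  sSup (largeIndices k n ν)

/-- The tail sum `∑_{i > m} Λ_i^ν`. -/
noncomputable def eigenvalueTail (k : Z → Z → ℝ) (ν : ProbabilityMeasure Z) (m : ℕ) : ℝ≥0∞ :=
  ∑' i : Set.Ioi m, ENNReal.ofReal (kernelEigenvalue k ν i)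

/-- The indices `i ≥ 1` of the positive eigenvalues. -/
def positiveIndices (k : Z → Z → ℝ) (ν : ProbabilityMeasure Z) : Set ℕ :=
  {i | 1 ≤ i ∧ 0 < kernelEigenvalue k ν i}

/-- `(ψ_i)` are eigenfunctions of `K_ν` for its positive eigenvalues `Λ_i^ν`, orthonormal in
`L²(ν)`. The equation `K_ν ψ_i = Λ_i ψ_i` holds at every point, that is, `ψ_i` is the continuous
representative of the eigenvector. -/
structure IsEigenfunctionSystem (k : Z → Z → ℝ) (ν : ProbabilityMeasure Z)
    (ψ : ℕ → Z → ℝ) : Prop where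
  memLp : ∀ i ∈ positiveIndices k ν, MemLp (ψ i) 2 (ν : Measure Z)
  eigen : ∀ i ∈ positiveIndices k ν, ∀ z,
    ∫ z', k z z' * ψ i z' ∂(ν : Measure Z) = kernelEigenvalue k ν i * ψ i z
  orthonormal : ∀ i ∈ positiveIndices k ν, ∀ j ∈ positiveIndices k ν,
    ∫ z, ψ i z * ψ j z ∂(ν : Measure Z) = if i = j then 1 else 0

/-- `sup_i ‖ψ_i‖_∞`, over the indices of the positive eigenvalues. -/
noncomputable def eigenfunctionBound (k : Z → Z → ℝ) (ν : ProbabilityMeasure Z)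
    (ψ : ℕ → Z → ℝ) : ℝ≥0∞ :=
  ⨆ i ∈ positiveIndices k ν, ⨆ z, ‖ψ i z‖ₑ

end Spectrum

/-! ### Counting eigenvalues of a symmetric operator of trace at most one -/

section SpectralCounting

open Submodule

variable {E : Type*} [NormedAddCommGroup E] [InnerProductSpace ℝ E]

/-! Let `J` be the inclusion of `H_k` into `L²(ν)`. Its adjoint is integration against the kernel,
so `K_ν = J J*`. For an orthonormal family `w_i` in `H_k`, reproducing gives `∑ w_i(z)² ≤ k(z,z) ≤
1`; hence `J` is Hilbert–Schmidt with squared norm at most 1, `K_ν` is compact with trace at most 1,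
and `i Λ_i ≤ 1`, which yields `n(ν) ≤ n`.

Lower bound: let `V` be the image under `J*` of the eigenvectors with eigenvalue at least `1/n`; its
dimension is at most `n(ν)`. On `Vᗮ` one has `‖J g‖² ≤ ‖g‖²/n`, so the unit vectors of `Vᗮ` are
admissible perturbations, and testing with Dirac masses gives `|g(z)| ≤ R ‖g‖` there. This bound no
longer mentions `ν`: for every `ρ` it makes the squared Hilbert–Schmidt norm of the inclusion into
`L²(ρ)`, restricted to `Vᗮ`, at most `R²`. Removing `dim V` dimensions leaves at least the
eigenvalue tail (`sum_Ico_orderedEigenvalue_le`), so the tail is at most `R²`.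

Upper bound: the functions `√Λ_i ψ_i` form a Hilbert basis of `H_k`, because a function orthogonal
to all of them vanishes almost everywhere. Expand `g(z)` in this basis and split at `n(ν)`.
Cauchy–Schwarz with Bessel's inequality in `L²(ν)` controls the head, and with Bessel's inequality
in `H_k` the tail. -/

/-- The span of the eigenvectors of `T` with eigenvalue at least `t`. -/
def eigenspan (T : E →L[ℝ] E) (t : ℝ) : Submodule ℝ E :=
  span ℝ {f | ∃ μ : ℝ, t ≤ μ ∧ T f = μ • f}

/-- The `i`-th largest positive eigenvalue of `T`, counted with multiplicity. -/
noncomputable def orderedEigenvalue (T : E →L[ℝ] E) (i : ℕ) : ℝ :=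
  sSup {t : ℝ | 0 < t ∧ (i : Cardinal) ≤ Module.rank ℝ (eigenspan T t)}

theorem eigenspan_antitone (T : E →L[ℝ] E) : Antitone (eigenspan T) := fun _ _ h =>
  span_mono fun _ ⟨μ, hμ, hf⟩ => ⟨μ, h.trans hμ, hf⟩

theorem inner_eq_zero_of_eigenvalue_ne {T : E →L[ℝ] E} (hT : (T : E →ₗ[ℝ] E).IsSymmetric)
    {f g : E} {μ ν : ℝ} (hf : T f = μ • f) (hg : T g = ν • g) (h : μ ≠ ν) :
    inner ℝ f g = 0 := by
  have := hT f g
  simp only [ContinuousLinearMap.coe_coe, hf, hg, real_inner_smul_left,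
    real_inner_smul_right] at this
  have h' : (μ - ν) * inner ℝ f g = 0 := by linarith
  exact (mul_eq_zero.mp h').resolve_left (sub_ne_zero.mpr h)

theorem orthonormal_snoc {N : ℕ} {f : Fin N → E} (hf : Orthonormal ℝ f) {u : E} (hu : ‖u‖ = 1)
    (h : ∀ i, inner ℝ (f i) u = 0) : Orthonormal ℝ (Fin.snoc f u : Fin (N + 1) → E) := by
  refine ⟨fun i => ?_, fun i j hij => ?_⟩
  · induction i using Fin.lastCases with
    | last => simpa using hu
    | cast i => simpa using hf.1 i
  · induction i using Fin.lastCases with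
    | last =>
      induction j using Fin.lastCases with
      | last => exact absurd rfl hij
      | cast j => simpa [real_inner_comm] using h j
    | cast i =>
      induction j using Fin.lastCases with
      | last => simpa using h i
      | cast j => simpa using hf.2 (fun e => hij (by rw [e]))

/-- Gram–Schmidt that stays inside the eigenvectors: the rank hypothesis always supplies an
eigenvector outside the span found so far. -/
theorem exists_orthonormal_eigenvectors {T : E →L[ℝ] E} (hT : (T : E →ₗ[ℝ] E).IsSymmetric)
    (t : ℕ → ℝ) (N : ℕ)
    (h : ∀ i < N, ((i + 1 : ℕ) : Cardinal) ≤ Module.rank ℝ (eigenspan T (t i))) :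
    ∃ (f : Fin N → E) (μ : Fin N → ℝ), Orthonormal ℝ f ∧
      ∀ i, T (f i) = μ i • f i ∧ t i ≤ μ i := by
  induction N with
  | zero => exact ⟨Fin.elim0, Fin.elim0, ⟨fun i => i.elim0, fun i => i.elim0⟩, fun i => i.elim0⟩
  | succ N ih =>
    obtain ⟨f, μ, hf, hfμ⟩ := ih fun i hi => h i (hi.trans N.lt_succ_self)
    obtain ⟨u, ⟨α, hα, hu⟩, huf⟩ :
        ∃ u, (∃ α : ℝ, t N ≤ α ∧ T u = α • u) ∧ u ∉ span ℝ (Set.range f) := by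
      by_contra! hcon
      have hle : eigenspan T (t N) ≤ span ℝ (Set.range f) := span_le.mpr fun u hu => hcon u hu
      have h1 := (h N N.lt_succ_self).trans
        ((Submodule.rank_mono hle).trans (rank_span_le (Set.range f)))
      have h2 : Cardinal.mk (Set.range f) ≤ (N : Cardinal) := by
        simpa using Cardinal.mk_range_le_lift (f := f)
      have h3 := h1.trans h2
      rw [Nat.cast_le] at h3
      omega
    set w : E := u - ∑ i, inner ℝ (f i) u • f i with hw
    have hw0 : w ≠ 0 := by
      intro h0
      apply huf
      rw [sub_eq_zero.mp h0]
      exact sum_mem fun i _ => smul_mem _ _ (subset_span ⟨i, rfl⟩)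
    have hwT : T w = α • w := by
      rw [hw, map_sub, map_sum, hu, smul_sub, Finset.smul_sum]
      congr 1
      refine Finset.sum_congr rfl fun i _ => ?_
      rw [map_smul, (hfμ i).1, smul_smul, smul_smul]
      -- Eigenvectors with another eigenvalue are already orthogonal to `u`, so only vectors of the
      -- same eigenvalue are subtracted and `w` remains an eigenvector.
      by_cases hi : μ i = α
      · rw [hi, mul_comm]
      · rw [inner_eq_zero_of_eigenvalue_ne hT (hfμ i).1 hu hi]; simp
    have hwf : ∀ i, inner ℝ (f i) w = 0 := by
      intro i
      rw [hw, inner_sub_right, hf.inner_right_fintype, sub_self]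
    refine ⟨Fin.snoc f (‖w‖⁻¹ • w), Fin.snoc μ α, orthonormal_snoc hf ?_ ?_, fun i => ?_⟩
    · rw [norm_smul, norm_inv, norm_norm, inv_mul_cancel₀ (norm_ne_zero_iff.mpr hw0)]
    · intro i
      rw [real_inner_smul_right, hwf, mul_zero]
    · induction i using Fin.lastCases with
      | last => simpa [hwT] using ⟨smul_comm _ _ _, hα⟩
      | cast i => simpa using hfμ i

variable {T : E →L[ℝ] E} (hT : (T : E →ₗ[ℝ] E).IsSymmetric)
  (htr : ∀ (N : ℕ) (f : Fin N → E), Orthonormal ℝ f → ∑ i, inner ℝ (T (f i)) (f i) ≤ 1)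

include hT htr

theorem natCast_mul_le_of_le_rank_eigenspan {t : ℝ} {N : ℕ}
    (h : (N : Cardinal) ≤ Module.rank ℝ (eigenspan T t)) : N * t ≤ 1 := by
  obtain ⟨f, μ, hf, hfμ⟩ := exists_orthonormal_eigenvectors hT (fun _ => t) N fun i hi =>
    le_trans (Nat.cast_le.mpr hi) h
  refine le_trans ?_ (htr N f hf)
  have : ∀ i, t ≤ inner ℝ (T (f i)) (f i) := fun i => by
    rw [(hfμ i).1, real_inner_smul_left, real_inner_self_eq_norm_sq, hf.1 i]
    simpa using (hfμ i).2
  simpa using Finset.sum_le_sum fun i (_ : i ∈ Finset.univ) => this i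

theorem finiteDimensional_eigenspan {t : ℝ} (ht : 0 < t) :
    FiniteDimensional ℝ (eigenspan T t) := by
  by_contra hcon
  obtain ⟨N, hN⟩ := exists_nat_gt (1 / t)
  have h : (N : Cardinal) ≤ Module.rank ℝ (eigenspan T t) :=
    (Cardinal.natCast_lt_aleph0).le.trans
      (not_lt.mp fun h => hcon (Module.rank_lt_aleph0_iff.mp h))
  have := natCast_mul_le_of_le_rank_eigenspan hT htr h
  rw [div_lt_iff₀ ht] at hN
  linarith

theorem bddAbove_orderedEigenvalue {i : ℕ} (hi : 1 ≤ i) :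
    BddAbove {t : ℝ | 0 < t ∧ (i : Cardinal) ≤ Module.rank ℝ (eigenspan T t)} := by
  -- For `i = 0` the set would be all of `(0, ∞)`; with `i ≥ 1` one eigenvector exhausts a trace of
  -- 1.
  refine ⟨1, fun t ⟨_, h⟩ => ?_⟩
  have := natCast_mul_le_of_le_rank_eigenspan hT htr
    (le_trans (Nat.cast_le.mpr hi : ((1 : ℕ) : Cardinal) ≤ i) h)
  simpa using this

/-- Distinct eigenvalues have orthogonal eigenvectors, and more than `1/t` of them would exceed the
trace bound. -/
theorem finite_eigenvalues_ge {t : ℝ} (ht : 0 < t) :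
    {μ : ℝ | t ≤ μ ∧ ∃ f : E, f ≠ 0 ∧ T f = μ • f}.Finite := by
  by_contra hcon
  obtain ⟨N, hN⟩ := exists_nat_gt (1 / t)
  obtain ⟨s, hs, hcard⟩ := (Set.not_finite.mp hcon).exists_subset_card_eq N
  choose! f hf0 hf using fun μ (hμ : μ ∈ s) => (hs hμ).2
  have e := s.equivFinOfCardEq hcard
  set g : Fin N → E := fun i => ‖f (e.symm i)‖⁻¹ • f (e.symm i) with hg
  have hT' : ∀ i, T (g i) = (e.symm i : ℝ) • g i := fun i => by
    rw [hg, map_smul, hf _ (e.symm i).2, smul_comm]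
  have hgo : Orthonormal ℝ g := by
    refine ⟨fun i => ?_, fun i j hij => ?_⟩
    · rw [hg, norm_smul, norm_inv, norm_norm,
        inv_mul_cancel₀ (norm_ne_zero_iff.mpr (hf0 _ (e.symm i).2))]
    · exact inner_eq_zero_of_eigenvalue_ne hT (hT' i) (hT' j) fun h =>
        hij (e.symm.injective (Subtype.ext h))
  have h1 := htr N g hgo
  have h2 : ∀ i, t ≤ inner ℝ (T (g i)) (g i) := fun i => by
    rw [hT', real_inner_smul_left, real_inner_self_eq_norm_sq, hgo.1 i]
    simpa using (hs (e.symm i).2).1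
  have h3 : N * t ≤ 1 := by
    simpa using (Finset.sum_le_sum fun i (_ : i ∈ Finset.univ) => h2 i).trans h1
  rw [div_lt_iff₀ ht] at hN
  linarith

/-- Only finitely many eigenvalues lie above `t/2`, so none lies just below `t`. This makes the
supremum in `orderedEigenvalue` attained. -/
theorem exists_eigenspan_eq {t : ℝ} (ht : 0 < t) :
    ∃ s₀ < t, ∀ s, s₀ < s → s ≤ t → eigenspan T s = eigenspan T t := by
  have hfin := finite_eigenvalues_ge hT htr (half_pos ht)
  have h1 : ∀ᶠ s in nhdsWithin t (Set.Iio t),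
      ∀ μ ∈ {μ : ℝ | t / 2 ≤ μ ∧ ∃ f : E, f ≠ 0 ∧ T f = μ • f}, μ < t → μ < s := by
    rw [Filter.eventually_all_finite hfin]
    intro μ _
    by_cases h : μ < t
    · filter_upwards [mem_nhdsWithin_of_mem_nhds (lt_mem_nhds h)] with s hs _ using hs
    · exact Filter.Eventually.of_forall fun s h' => absurd h' h
  have h2 : ∀ᶠ s in nhdsWithin t (Set.Iio t), t / 2 < s ∧ s < t := by
    filter_upwards [mem_nhdsWithin_of_mem_nhds (lt_mem_nhds (half_lt_self ht)),
      self_mem_nhdsWithin] with s h h' using ⟨h, h'⟩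
  obtain ⟨s₀, hs₀, hs₁, hs₂⟩ := (h1.and h2).exists
  refine ⟨s₀, hs₂, fun s hs hst => le_antisymm (span_le.mpr ?_) (eigenspan_antitone T hst)⟩
  rintro f ⟨μ, hμ, hf⟩
  by_cases hf0 : f = 0
  · rw [hf0]; exact zero_mem _
  · refine subset_span ⟨μ, ?_, hf⟩
    by_contra! hlt
    have := hs₀ μ ⟨by linarith, f, hf0, hf⟩ hlt
    linarith

/-- The ordered eigenvalues are characterised by the dimensions of the spans of eigenvectors. -/
theorem le_orderedEigenvalue_iff {t : ℝ} (ht : 0 < t) {i : ℕ} (hi : 1 ≤ i) :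
    t ≤ orderedEigenvalue T i ↔ (i : Cardinal) ≤ Module.rank ℝ (eigenspan T t) := by
  refine ⟨fun h => ?_, fun h => le_csSup (bddAbove_orderedEigenvalue hT htr hi) ⟨ht, h⟩⟩
  obtain ⟨s₀, hs₀, hs⟩ := exists_eigenspan_eq hT htr ht
  have hne : {t : ℝ | 0 < t ∧ (i : Cardinal) ≤ Module.rank ℝ (eigenspan T t)}.Nonempty := by
    by_contra hne
    rw [orderedEigenvalue, Set.not_nonempty_iff_eq_empty.mp hne, Real.sSup_empty] at h
    linarith
  obtain ⟨s, ⟨_, hsi⟩, hs'⟩ := exists_lt_of_lt_csSup hne (hs₀.trans_le h)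
  rcases le_or_gt s t with hst | hst
  · rwa [← hs s hs' hst]
  · exact hsi.trans (Submodule.rank_mono (eigenspan_antitone T hst.le))

omit hT htr in
theorem orderedEigenvalue_nonneg (T : E →L[ℝ] E) (i : ℕ) : 0 ≤ orderedEigenvalue T i :=
  Real.sSup_nonneg fun _ h => h.1.le

theorem orderedEigenvalue_anti {i j : ℕ} (hi : 1 ≤ i) (hij : i ≤ j) :
    orderedEigenvalue T j ≤ orderedEigenvalue T i := by
  rcases (orderedEigenvalue_nonneg T j).eq_or_lt with h | h
  · rw [← h]; exact orderedEigenvalue_nonneg T i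
  · exact (le_orderedEigenvalue_iff hT htr h hi).mpr (le_trans (Nat.cast_le.mpr hij)
      ((le_orderedEigenvalue_iff hT htr h (hi.trans hij)).mp le_rfl))

end SpectralCounting

/-! ### Compactness and quadratic form bounds -/

section CompactOperators

variable {E F : Type*} [NormedAddCommGroup E] [InnerProductSpace ℝ E]
  [NormedAddCommGroup F] [InnerProductSpace ℝ F]

theorem norm_sq_apply_le_of_forall_unit {A : E →L[ℝ] F} {K : Submodule ℝ E} {c : ℝ}
    (h : ∀ u ∈ K, ‖u‖ = 1 → ‖A u‖ ^ 2 ≤ c) {y : E} (hy : y ∈ K) :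
    ‖A y‖ ^ 2 ≤ c * ‖y‖ ^ 2 := by
  by_cases hy0 : y = 0
  · simp [hy0]
  have hn : ‖y‖ ≠ 0 := norm_ne_zero_iff.mpr hy0
  have h1 := h (‖y‖⁻¹ • y) (K.smul_mem _ hy) (by
    rw [norm_smul, norm_inv, norm_norm, inv_mul_cancel₀ hn])
  rw [map_smul, norm_smul, norm_inv, norm_norm, mul_pow, inv_pow, inv_mul_le_iff₀ (by positivity)]
    at h1
  linarith

/-- A Hilbert–Schmidt operator is compact. -/
theorem isCompactOperator_of_sum_norm_sq_le [CompleteSpace F] (A : E →L[ℝ] F) (C : ℝ)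
    (h : ∀ (N : ℕ) (v : Fin N → E), Orthonormal ℝ v → ∑ i, ‖A (v i)‖ ^ 2 ≤ C) :
    IsCompactOperator A := by
  set s : Set ℝ := {c | ∃ (N : ℕ) (v : Fin N → E), Orthonormal ℝ v ∧ ∑ i, ‖A (v i)‖ ^ 2 = c}
    with hs
  have hbdd : BddAbove s := ⟨C, by rintro _ ⟨N, v, hv, rfl⟩; exact h N v hv⟩
  have hne : s.Nonempty :=
    ⟨_, 0, Fin.elim0, ⟨fun i => i.elim0, fun i => i.elim0⟩, rfl⟩
  refine isClosed_setOfPred_isCompactOperator.closure_subset (Metric.mem_closure_iff.mpr ?_)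
  intro ε hε
  have hε2 : 0 < (ε / 2) ^ 2 := by positivity
  -- The family `v` nearly attains the Hilbert–Schmidt supremum, so appending any further orthogonal
  -- unit vector gains at most `(ε/2)²`.
  obtain ⟨_, ⟨N, v, hv, rfl⟩, hlt⟩ := exists_lt_of_lt_csSup hne (sub_lt_self (sSup s) hε2)
  set K : Submodule ℝ E := Submodule.span ℝ (Set.range v) with hK
  have hfin : FiniteDimensional ℝ K := FiniteDimensional.span_of_finite ℝ (Set.finite_range v)
  have hunit : ∀ u ∈ Kᗮ, ‖u‖ = 1 → ‖A u‖ ^ 2 ≤ (ε / 2) ^ 2 := by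
    intro u hu hu1
    have ho := orthonormal_snoc hv hu1 fun i => hu _ (Submodule.subset_span ⟨i, rfl⟩)
    have := le_csSup hbdd ⟨N + 1, _, ho, rfl⟩
    rw [Fin.sum_univ_castSucc] at this
    simp only [Fin.snoc_castSucc, Fin.snoc_last] at this
    linarith
  refine ⟨A ∘L K.subtypeL ∘L K.orthogonalProjectionOnto, ?_, ?_⟩
  · have : IsCompactOperator (A ∘L K.subtypeL) :=
      isCompactOperator_of_locallyCompactSpace_rng (A ∘L K.subtypeL)
    exact this.comp_clm K.orthogonalProjectionOnto
  · rw [dist_eq_norm]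
    refine lt_of_le_of_lt (ContinuousLinearMap.opNorm_le_bound _ (half_pos hε).le fun x => ?_)
      (half_lt_self hε)
    have hy : x - K.starProjection x ∈ Kᗮ := K.sub_starProjection_mem_orthogonal x
    have h1 := norm_sq_apply_le_of_forall_unit hunit hy
    have h2 : ‖x - K.starProjection x‖ ≤ ‖x‖ := by
      rw [← Submodule.starProjection_orthogonal_val]
      exact Submodule.norm_starProjection_apply_le _ x
    rw [← mul_pow] at h1
    have h3 := abs_le_of_sq_le_sq h1 (by positivity)
    have h4 : (A - A ∘L K.subtypeL ∘L K.orthogonalProjectionOnto) x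
        = A (x - K.starProjection x) := by
      rw [map_sub]; rfl
    rw [h4]
    exact (abs_le.mp h3).2.trans (by gcongr)

-- The norm of a self-adjoint operator is its spectral radius, and non-zero spectral values of a
-- compact operator are eigenvalues.
open Module.End in
theorem norm_le_of_forall_hasEigenvalue_abs_le [CompleteSpace E] {S : E →L[ℝ] E}
    (hS : IsCompactOperator S) (hS' : (S : E →ₗ[ℝ] E).IsSymmetric) {t : ℝ} (ht : 0 ≤ t)
    (h : ∀ μ, HasEigenvalue (S : Module.End ℝ E) μ → |μ| ≤ t) : ‖S‖ ≤ t := by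
  have h1 : spectralRadius ℝ S ≤ ENNReal.ofReal t := by
    refine iSup₂_le fun μ hμ => ?_
    rw [← enorm_eq_nnnorm, ← ofReal_norm]
    apply ENNReal.ofReal_le_ofReal
    by_cases h0 : μ = 0
    · simpa [h0] using ht
    · exact h μ ((hS.hasEigenvalue_iff_mem_spectrum h0).mpr hμ)
  rw [S.spectralRadius_eq_nnnorm hS'.isSelfAdjoint, ← enorm_eq_nnnorm,
    ← ofReal_norm, ENNReal.ofReal_le_ofReal_iff ht] at h1
  exact h1

/-- On the orthogonal complement of the eigenvectors with eigenvalue at least `t`, a positive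
compact operator is bounded by `t`. -/
theorem inner_apply_le_of_mem_eigenspan_orthogonal [CompleteSpace E] {T : E →L[ℝ] E}
    (hT : IsCompactOperator T) (hT' : (T : E →ₗ[ℝ] E).IsSymmetric)
    (hpos : ∀ f, 0 ≤ inner ℝ (T f) f) {t : ℝ} (ht : 0 ≤ t) {f : E} (hf : f ∈ (eigenspan T t)ᗮ) :
    inner ℝ (T f) f ≤ t * ‖f‖ ^ 2 := by
  set W := (eigenspan T t)ᗮ with hW
  have hinv : ∀ w ∈ W, T w ∈ W := by
    intro w hw
    rw [hW, eigenspan, Submodule.mem_orthogonal] at hw ⊢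
    intro u hu
    induction hu using Submodule.span_induction with
    | mem u hu =>
      obtain ⟨μ, hμ, hu'⟩ := hu
      have h1 : inner ℝ u w = 0 := hw u (Submodule.subset_span ⟨μ, hμ, hu'⟩)
      have h2 := hT' u w
      simp only [ContinuousLinearMap.coe_coe] at h2
      rw [← h2, hu', real_inner_smul_left, h1, mul_zero]
    | zero => simp
    | add x y _ _ hx hy => rw [inner_add_left, hx, hy, add_zero]
    | smul a x _ hx => rw [real_inner_smul_left, hx, mul_zero]
  set S : W →L[ℝ] W := T.restrict hinv with hSdef
  have hS : IsCompactOperator S := hT.restrict' hinv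
  have hS' : (S : W →ₗ[ℝ] W).IsSymmetric := hT'.restrict_invariant hinv
  have hSn : ‖S‖ ≤ t := by
    refine norm_le_of_forall_hasEigenvalue_abs_le hS hS' ht fun μ hμ => ?_
    obtain ⟨v, hv⟩ := hμ.exists_hasEigenvector
    have hv1 : T v = μ • (v : E) := congrArg Subtype.val hv.apply_eq_smul
    have hv0 : (v : E) ≠ 0 := fun h => hv.2 (Subtype.ext h)
    have hvn : 0 < ‖(v : E)‖ ^ 2 := by have := norm_pos_iff.mpr hv0; positivity
    have hμ0 : 0 ≤ μ := by
      have := hpos v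
      rw [hv1, real_inner_smul_left, real_inner_self_eq_norm_sq] at this
      exact nonneg_of_mul_nonneg_left this hvn
    rw [abs_of_nonneg hμ0]
    by_contra! hlt
    -- Such a `v` would lie both in the eigenspan and in its orthogonal complement.
    have hmem : (v : E) ∈ eigenspan T t := Submodule.subset_span ⟨μ, hlt.le, hv1⟩
    exact hv0 (inner_self_eq_zero.mp (v.2 _ hmem))
  have h1 : inner ℝ (T f) f = inner ℝ (S ⟨f, hf⟩) (⟨f, hf⟩ : W) := rfl
  have h2 : ‖(⟨f, hf⟩ : W)‖ = ‖f‖ := rfl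
  rw [h1]
  calc inner ℝ (S ⟨f, hf⟩) (⟨f, hf⟩ : W) ≤ ‖S ⟨f, hf⟩‖ * ‖(⟨f, hf⟩ : W)‖ := real_inner_le_norm _ _
    _ ≤ (‖S‖ * ‖(⟨f, hf⟩ : W)‖) * ‖(⟨f, hf⟩ : W)‖ := by gcongr; exact S.le_opNorm _
    _ ≤ t * ‖f‖ ^ 2 := by rw [h2, pow_two, ← mul_assoc]; gcongr

end CompactOperators

/-! ### Eigenvalue tails and Hilbert–Schmidt norms on complements -/

theorem sum_Ico_le_sum_range_mul_one_sub {lam b : ℕ → ℝ} {m M : ℕ} (h0 : ∀ i, 0 ≤ lam i)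
    (hlam : Antitone lam) (hb0 : ∀ i < M, 0 ≤ b i) (hb1 : ∀ i < M, b i ≤ 1)
    (hb : ∑ i ∈ Finset.range M, b i ≤ m) :
    ∑ i ∈ Finset.Ico m M, lam i ≤ ∑ i ∈ Finset.range M, lam i * (1 - b i) := by
  rcases le_or_gt M m with hM | hM
  · rw [Finset.Ico_eq_empty_of_le hM, Finset.sum_empty]
    exact Finset.sum_nonneg fun i hi => mul_nonneg (h0 i)
      (sub_nonneg.mpr (hb1 i (Finset.mem_range.mp hi)))
  -- Bathtub principle: total mass `m`, at most 1 per index, removes most from decreasing weights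
  -- when placed on the first `m` indices. The threshold weight `lam m` compares term by term.
  have h1 : ∀ i ∈ Finset.range M, lam m * ((if i < m then 1 else 0) - b i) +
      (if i < m then 0 else lam i) ≤ lam i * (1 - b i) := by
    intro i hi
    have hi' := Finset.mem_range.mp hi
    split_ifs with him
    · rw [add_zero]
      exact mul_le_mul_of_nonneg_right (hlam him.le) (sub_nonneg.mpr (hb1 i hi'))
    · have := mul_le_mul_of_nonneg_right (hlam (not_lt.mp him)) (hb0 i hi')
      linarith
  have h2 := Finset.sum_le_sum h1
  rw [Finset.sum_add_distrib, ← Finset.mul_sum, Finset.sum_sub_distrib, Finset.sum_ite,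
    Finset.sum_ite] at h2
  have h3 : (Finset.range M).filter (fun i => i < m) = Finset.range m := by
    ext i; simp; omega
  have h4 : (Finset.range M).filter (fun i => ¬ i < m) = Finset.Ico m M := by
    ext i; simp; omega
  rw [h3, h4] at h2
  simp only [Finset.sum_const, Finset.card_range, nsmul_eq_mul, mul_one] at h2
  have h5 : 0 ≤ lam m * (m - ∑ i ∈ Finset.range M, b i) :=
    mul_nonneg (h0 m) (sub_nonneg.mpr hb)
  linarith

section AdjointSquare

open ContinuousLinearMap

variable {H E : Type*} [NormedAddCommGroup H] [InnerProductSpace ℝ H] [CompleteSpace H]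
  [NormedAddCommGroup E] [InnerProductSpace ℝ E] [CompleteSpace E]

theorem inner_comp_adjoint_apply (J : H →L[ℝ] E) (f g : E) :
    inner ℝ ((J ∘L adjoint J) f) g = inner ℝ (adjoint J f) (adjoint J g) :=
  (adjoint_inner_right J _ _).symm

theorem isSymmetric_comp_adjoint (J : H →L[ℝ] E) :
    ((J ∘L adjoint J : E →L[ℝ] E) : E →ₗ[ℝ] E).IsSymmetric := fun f g => by
  rw [ContinuousLinearMap.coe_coe, inner_comp_adjoint_apply, real_inner_comm,
    ← inner_comp_adjoint_apply, real_inner_comm]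

theorem inner_comp_adjoint_self (J : H →L[ℝ] E) (f : E) :
    inner ℝ ((J ∘L adjoint J) f) f = ‖adjoint J f‖ ^ 2 := by
  rw [inner_comp_adjoint_apply, real_inner_self_eq_norm_sq]

/-- An operator and its adjoint have the same Hilbert–Schmidt norm, here for `J` restricted to `U`.
Parseval in the span of the projected vectors, an exchange of sums and Bessel in `E` keep everything
finite. -/
theorem sum_norm_sq_starProjection_adjoint_le (J : H →L[ℝ] E) (U : Submodule ℝ H)
    [U.HasOrthogonalProjection] {c : ℝ}
    (hc : ∀ (N : ℕ) (w : Fin N → H), Orthonormal ℝ w → (∀ i, w i ∈ U) → ∑ i, ‖J (w i)‖ ^ 2 ≤ c)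
    {M : ℕ} {f : Fin M → E} (hf : Orthonormal ℝ f) :
    ∑ i, ‖U.starProjection (adjoint J (f i))‖ ^ 2 ≤ c := by
  set x : Fin M → H := fun i => U.starProjection (adjoint J (f i)) with hx
  set X : Submodule ℝ H := Submodule.span ℝ (Set.range x) with hX
  have hfin : FiniteDimensional ℝ X := FiniteDimensional.span_of_finite ℝ (Set.finite_range x)
  have hXU : X ≤ U := Submodule.span_le.mpr (by
    rintro _ ⟨i, rfl⟩; exact Submodule.starProjection_apply_mem U _)
  set e := stdOrthonormalBasis ℝ X with he
  set w : Fin (Module.finrank ℝ X) → H := fun l => e l with hw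
  have hwo : Orthonormal ℝ w := e.orthonormal.comp_linearIsometry X.subtypeₗᵢ
  have hwU : ∀ l, w l ∈ U := fun l => hXU (e l).2
  have h1 : ∀ i, ‖x i‖ ^ 2 = ∑ l, inner ℝ (J (w l)) (f i) ^ 2 := by
    intro i
    have hi : x i ∈ X := Submodule.subset_span ⟨i, rfl⟩
    have h2 := e.sum_sq_norm_inner_right ⟨x i, hi⟩
    have h3 : ‖(⟨x i, hi⟩ : X)‖ = ‖x i‖ := rfl
    rw [← h3, ← h2]
    refine Finset.sum_congr rfl fun l _ => ?_
    have h4 : inner ℝ (e l) (⟨x i, hi⟩ : X) = inner ℝ (w l) (x i) := rfl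
    rw [h4, Real.norm_eq_abs, sq_abs, ← adjoint_inner_right, hx]
    simp only
    rw [← Submodule.inner_starProjection_left_eq_right,
      Submodule.starProjection_eq_self_iff.mpr (hwU l)]
  calc ∑ i, ‖x i‖ ^ 2 = ∑ l, ∑ i, inner ℝ (J (w l)) (f i) ^ 2 := by
        rw [Finset.sum_comm]; exact Finset.sum_congr rfl fun i _ => h1 i
    _ ≤ ∑ l, ‖J (w l)‖ ^ 2 := by
        refine Finset.sum_le_sum fun l _ => ?_
        refine le_trans (le_of_eq ?_) (hf.sum_inner_products_le (J (w l)) (s := Finset.univ))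
        exact Finset.sum_congr rfl fun i _ => by
          rw [Real.norm_eq_abs, sq_abs, real_inner_comm]
    _ ≤ c := hc _ w hwo hwU

theorem sum_norm_sq_starProjection_le_finrank (V : Submodule ℝ H) [FiniteDimensional ℝ V]
    {M : ℕ} {h : Fin M → H} (hh : Orthonormal ℝ h) :
    ∑ i, ‖V.starProjection (h i)‖ ^ 2 ≤ Module.finrank ℝ V := by
  have := sum_norm_sq_starProjection_adjoint_le (ContinuousLinearMap.id ℝ H) V
    (c := Module.finrank ℝ V) (fun N w hw hwV => ?_) hh
  · simpa [adjoint_id] using this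
  · have h1 : LinearIndependent ℝ (fun i => (⟨w i, hwV i⟩ : V)) :=
      LinearIndependent.of_comp V.subtype hw.linearIndependent
    have h2 := h1.fintype_card_le_finrank
    simpa [hw.1] using h2

variable {J : H →L[ℝ] E}
  (htr : ∀ (N : ℕ) (w : Fin N → H), Orthonormal ℝ w → ∑ i, ‖J (w i)‖ ^ 2 ≤ 1)

include htr

theorem sum_inner_comp_adjoint_le (N : ℕ) (f : Fin N → E) (hf : Orthonormal ℝ f) :
    ∑ i, inner ℝ ((J ∘L adjoint J) (f i)) (f i) ≤ 1 := by
  have := sum_norm_sq_starProjection_adjoint_le J ⊤ (fun N w hw _ => htr N w hw) hf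
  simpa only [inner_comp_adjoint_self, Submodule.starProjection_top,
    ContinuousLinearMap.id_apply] using this

theorem isCompactOperator_comp_adjoint : IsCompactOperator (J ∘L adjoint J) :=
  (isCompactOperator_of_sum_norm_sq_le J 1 htr).comp_clm (adjoint J)

/-- A lower bound for the Hilbert–Schmidt norm on the complement of an `m`-dimensional space. -/
theorem sum_Ico_orderedEigenvalue_le {V : Submodule ℝ H} [FiniteDimensional ℝ V] {m : ℕ}
    (hV : Module.finrank ℝ V ≤ m) {c : ℝ}
    (hc : ∀ (N : ℕ) (w : Fin N → H), Orthonormal ℝ w → (∀ i, w i ∈ Vᗮ) →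
      ∑ i, ‖J (w i)‖ ^ 2 ≤ c) (M : ℕ) :
    ∑ i ∈ Finset.Ico m M, orderedEigenvalue (J ∘L adjoint J) (i + 1) ≤ c := by
  set T := J ∘L adjoint J with hTdef
  have hT := isSymmetric_comp_adjoint J
  have htr' := sum_inner_comp_adjoint_le htr
  have hc0 : 0 ≤ c := by
    simpa using hc 0 Fin.elim0 ⟨fun i => i.elim0, fun i => i.elim0⟩ (fun i => i.elim0)
  -- The induction only discards vanishing eigenvalues; in the remaining case all of `lam 0, …, lam
  -- M` are positive and have eigenvectors.
  induction M with
  | zero => simpa using hc0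
  | succ M ih =>
    rcases lt_or_ge M m with hm | hm
    · rw [Finset.Ico_eq_empty_of_le (Nat.succ_le_of_lt hm)]; simpa using hc0
    rcases (orderedEigenvalue_nonneg T (M + 1)).eq_or_lt with h0 | h0
    · rw [Finset.sum_Ico_succ_top hm, ← h0, add_zero]; exact ih
    set lam : ℕ → ℝ := fun i => orderedEigenvalue T (i + 1) with hlam
    have hanti : Antitone lam := fun i j hij =>
      orderedEigenvalue_anti hT htr' (by omega) (by omega)
    have hpos : ∀ i < M + 1, 0 < lam i := fun i hi => h0.trans_le (hanti (by omega))
    obtain ⟨f, μ, hf, hfμ⟩ := exists_orthonormal_eigenvectors hT lam (M + 1) fun i hi =>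
      (le_orderedEigenvalue_iff hT htr' (hpos i hi) (by omega)).mp le_rfl
    have hμ : ∀ i, 0 < μ i := fun i => (hpos i i.2).trans_le (hfμ i).2
    have hx : ∀ i j, inner ℝ (adjoint J (f i)) (adjoint J (f j)) = if i = j then μ i else 0 := by
      intro i j
      rw [← inner_comp_adjoint_apply, (hfμ i).1, real_inner_smul_left,
        orthonormal_iff_ite.mp hf]
      split_ifs <;> simp
    -- The vectors `J* f_i` are orthogonal with squared norms `μ_i`, so these are right singular
    -- vectors of `J`.
    set h : Fin (M + 1) → H := fun i => (√(μ i))⁻¹ • adjoint J (f i) with hh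
    have hho : Orthonormal ℝ h := by
      rw [orthonormal_iff_ite]
      intro i j
      simp only [hh]
      rw [real_inner_smul_left, real_inner_smul_right, hx]
      split_ifs with hij
      · subst hij
        have := Real.sqrt_pos.mpr (hμ i)
        have h5 := Real.mul_self_sqrt (hμ i).le
        field_simp
        nlinarith
      · simp
    have hb := sum_norm_sq_starProjection_le_finrank V hho
    have hU := sum_norm_sq_starProjection_adjoint_le J Vᗮ hc hf
    -- `b i` is the share of `h_i` lying in `V`; the shares add up to at most `dim V ≤ m`, as the
    -- bathtub inequality requires.
    set b : ℕ → ℝ := fun i => if hi : i < M + 1 then ‖V.starProjection (h ⟨i, hi⟩)‖ ^ 2 else 0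
      with hbdef
    have hbi : ∀ i : Fin (M + 1), b i = ‖V.starProjection (h i)‖ ^ 2 := fun i => by
      simp only [hbdef, dif_pos i.2]
    have hb1 : ∀ i : Fin (M + 1), b i ≤ 1 := fun i => by
      rw [hbi]
      refine pow_le_one₀ (norm_nonneg _) ?_
      have := Submodule.norm_starProjection_apply_le V (h i)
      rwa [hho.1 i] at this
    refine (sum_Ico_le_sum_range_mul_one_sub (b := b)
      (fun i => orderedEigenvalue_nonneg T (i + 1)) hanti
      (fun i _ => ?_) (fun i hi => hb1 ⟨i, hi⟩) ?_).trans ?_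
    · simp only [hbdef]; split_ifs <;> positivity
    · rw [Finset.sum_range]
      simp only [hbi]
      exact hb.trans (by exact_mod_cast hV)
    · rw [Finset.sum_range]
      refine (Finset.sum_le_sum fun i _ => ?_).trans hU
      have h1 : ‖adjoint J (f i)‖ ^ 2 = μ i := by
        rw [← real_inner_self_eq_norm_sq, hx, if_pos rfl]
      have h2 : ‖V.starProjection (adjoint J (f i))‖ ^ 2 = μ i * b i := by
        have h3 : adjoint J (f i) = √(μ i) • h i := by
          rw [hh, smul_smul, mul_inv_cancel₀ (Real.sqrt_pos.mpr (hμ i)).ne', one_smul]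
        rw [h3, map_smul, norm_smul, mul_pow, hbi, Real.norm_eq_abs, sq_abs,
          Real.sq_sqrt (hμ i).le]
      have h3 := Submodule.norm_sq_eq_add_norm_sq_starProjection (adjoint J (f i)) V
      calc lam i * (1 - b i) ≤ μ i * (1 - b i) :=
            mul_le_mul_of_nonneg_right (hfμ i).2 (sub_nonneg.mpr (hb1 i))
        _ = ‖Vᗮ.starProjection (adjoint J (f i))‖ ^ 2 := by
            rw [h1, h2] at h3; linarith

end AdjointSquare

/-! ### The inclusion of `H_k` into `L²(ν)` and the spectrum of `K_ν` -/

theorem le_sq_of_sq_eq_of_le_mul {a r x : ℝ} (ha : 0 ≤ a) (hx : x ^ 2 = a) (h : a ≤ r * x) :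
    a ≤ r ^ 2 := by
  rcases ha.eq_or_lt with h0 | h0
  · rw [← h0]; positivity
  · have h1 : a * a ≤ r ^ 2 * a := by
      calc a * a ≤ (r * x) * (r * x) := mul_le_mul h h ha (ha.trans h)
        _ = r ^ 2 * a := by rw [← hx]; ring
    exact le_of_mul_le_mul_right h1 h0

namespace PDKernel

open ContinuousLinearMap

variable {Z : Type*} [TopologicalSpace Z] (k : PDKernel Z)

/-- The function `k(z, ·)` of `H_k`. -/
noncomputable def feature (z : Z) : k.Hk := RKHS.kerFun k.Hk z 1

theorem apply_eq_inner (g : k.Hk) (z : Z) : g z = inner ℝ g (k.feature z) :=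
  (k.reproducing z).1 g

theorem inner_feature (z z' : Z) : inner ℝ (k.feature z) (k.feature z') = k z z' := by
  rw [← apply_eq_inner]; exact (k.reproducing z).2 z'

theorem continuous_feature : Continuous k.feature := by
  rw [continuous_iff_continuousAt]
  intro z₀
  rw [ContinuousAt, tendsto_iff_norm_sub_tendsto_zero]
  have h1 : ∀ z, ‖k.feature z - k.feature z₀‖ = √(k z z - 2 * k z z₀ + k z₀ z₀) := by
    intro z
    have h : ‖k.feature z - k.feature z₀‖ ^ 2 = k z z - 2 * k z z₀ + k z₀ z₀ := by
      rw [norm_sub_sq_real, ← real_inner_self_eq_norm_sq, ← real_inner_self_eq_norm_sq,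
        inner_feature, inner_feature, inner_feature]
    rw [← h, Real.sqrt_sq (norm_nonneg _)]
  simp only [h1]
  have h2 : Continuous fun z => √(k z z - 2 * k z z₀ + k z₀ z₀) := by
    have hk := k.continuous_toFun
    have h3 : Continuous fun z => k z z := hk.comp (continuous_id.prodMk continuous_id)
    have h4 : Continuous fun z => k z z₀ := hk.comp (continuous_id.prodMk continuous_const)
    fun_prop
  have h3 := h2.tendsto z₀
  have h4 : k z₀ z₀ - 2 * k z₀ z₀ + k z₀ z₀ = 0 := by ring
  rwa [h4, Real.sqrt_zero] at h3

theorem continuous_coe (g : k.Hk) : Continuous (g : Z → ℝ) := by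
  have : (g : Z → ℝ) = fun z => inner ℝ g (k.feature z) := funext (k.apply_eq_inner g)
  rw [this]
  exact continuous_const.inner k.continuous_feature

variable {k} (hk : ∀ z, k z z ≤ 1)

include hk in
theorem norm_feature_le (z : Z) : ‖k.feature z‖ ≤ 1 := by
  rw [← abs_norm, ← sq_le_one_iff_abs_le_one, ← real_inner_self_eq_norm_sq, inner_feature]
  exact hk z

include hk in
theorem abs_apply_le (g : k.Hk) (z : Z) : |g z| ≤ ‖g‖ := by
  rw [apply_eq_inner]
  exact (abs_real_inner_le_norm _ _).trans
    (mul_le_of_le_one_right (norm_nonneg g) (norm_feature_le hk z))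

variable [MeasurableSpace Z] [OpensMeasurableSpace Z] (ν : ProbabilityMeasure Z)

include hk in
theorem memLp_coe (g : k.Hk) : MemLp (g : Z → ℝ) 2 (ν : Measure Z) :=
  MemLp.of_bound (k.continuous_coe g).measurable.aestronglyMeasurable ‖g‖
    (Filter.Eventually.of_forall fun z => abs_apply_le hk g z)

/-- The inclusion of `H_k` into `L²(ν)`. -/
noncomputable def embed : k.Hk →L[ℝ] Lp ℝ 2 (ν : Measure Z) :=
  LinearMap.mkContinuous
    { toFun := fun g => (memLp_coe hk ν g).toLp g
      map_add' := fun f g => (MemLp.toLp_congr _ ((memLp_coe hk ν f).add (memLp_coe hk ν g))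
        (Filter.Eventually.of_forall fun z => by rw [RKHS.coe_add])).trans
          (MemLp.toLp_add _ _)
      map_smul' := fun c g => (MemLp.toLp_congr _ ((memLp_coe hk ν g).const_smul c)
        (Filter.Eventually.of_forall fun z => by rw [RKHS.coe_smul])).trans
          (MemLp.toLp_const_smul c _) } 1 (fun g => by
    rw [one_mul]
    refine Lp.norm_le_of_ae_bound (norm_nonneg g) ?_ |>.trans ?_
    · filter_upwards [(memLp_coe hk ν g).coeFn_toLp] with z hz
      exact (congrArg norm hz).trans_le (abs_apply_le hk g z)
    · simp [measureUnivNNReal])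

theorem coeFn_embed (g : k.Hk) : embed hk ν g =ᵐ[(ν : Measure Z)] g :=
  (memLp_coe hk ν g).coeFn_toLp

theorem inner_embed (f : Lp ℝ 2 (ν : Measure Z)) (g : k.Hk) :
    inner ℝ f (embed hk ν g) = ∫ z, g z * f z ∂(ν : Measure Z) := by
  rw [L2.inner_def]
  refine integral_congr_ae ?_
  filter_upwards [coeFn_embed hk ν g] with z hz
  rw [hz]; rfl

theorem adjoint_embed_apply (f : Lp ℝ 2 (ν : Measure Z)) (z : Z) :
    adjoint (embed hk ν) f z = ∫ z', k z z' * f z' ∂(ν : Measure Z) := by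
  rw [apply_eq_inner, adjoint_inner_left, inner_embed]
  refine integral_congr_ae (Filter.Eventually.of_forall fun z' => ?_)
  simp only
  rw [apply_eq_inner, inner_feature]

theorem isKernelEigenvector_iff (μ : ℝ) (f : Lp ℝ 2 (ν : Measure Z)) :
    IsKernelEigenvector k ν μ f ↔ (embed hk ν ∘L adjoint (embed hk ν)) f = μ • f := by
  rw [IsKernelEigenvector, Lp.ext_iff]
  have h1 : (embed hk ν ∘L adjoint (embed hk ν)) f =ᵐ[(ν : Measure Z)]
      fun z => ∫ z', k z z' * f z' ∂(ν : Measure Z) := by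
    refine (coeFn_embed hk ν (adjoint (embed hk ν) f)).trans
      (Filter.Eventually.of_forall fun z => adjoint_embed_apply hk ν f z)
  have h2 : (μ • f : Lp ℝ 2 (ν : Measure Z)) =ᵐ[(ν : Measure Z)] fun z => μ * f z :=
    Lp.coeFn_smul μ f
  exact ⟨fun h => (h1.trans h).trans h2.symm, fun h => (h1.symm.trans h).trans h2⟩

theorem kernelEigenvalue_eq (i : ℕ) :
    kernelEigenvalue k ν i = orderedEigenvalue (embed hk ν ∘L adjoint (embed hk ν)) i := by
  have h : ∀ t : ℝ, Submodule.span ℝ {f | ∃ μ : ℝ, t ≤ μ ∧ IsKernelEigenvector k ν μ f} =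
      eigenspan (embed hk ν ∘L adjoint (embed hk ν)) t := fun t => by
    simp only [eigenspan, isKernelEigenvector_iff hk ν]
  rw [kernelEigenvalue, orderedEigenvalue]
  congr 1
  ext t
  rw [Set.mem_ofPred_eq, Set.mem_ofPred_eq, h t]

theorem sum_norm_sq_embed_le {U : Submodule ℝ k.Hk} {r : ℝ}
    (hU : ∀ w ∈ U, ∀ z, |w z| ≤ r * ‖w‖) (N : ℕ) (w : Fin N → k.Hk) (hw : Orthonormal ℝ w)
    (hwU : ∀ i, w i ∈ U) : ∑ i, ‖embed hk ν (w i)‖ ^ 2 ≤ r ^ 2 := by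
  have h1 : ∀ z, ∑ i, w i z ^ 2 ≤ r ^ 2 := by
    intro z
    set a : ℝ := ∑ i, w i z ^ 2 with ha
    -- Extremal function at `z`: both `u z` and `‖u‖²` equal `a`, so the hypothesis gives `a ≤ r
    -- √a`.
    set u : k.Hk := ∑ i, w i z • w i with hu
    have hu1 : u z = a := by
      rw [apply_eq_inner, hu, sum_inner, ha]
      refine Finset.sum_congr rfl fun i _ => ?_
      rw [real_inner_smul_left, ← apply_eq_inner, pow_two]
    have hu2 : ‖u‖ ^ 2 = a := by
      rw [← real_inner_self_eq_norm_sq, hu, hw.inner_sum]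
      exact Finset.sum_congr rfl fun i _ => by simp [pow_two]
    have h3 := hU u (Submodule.sum_mem _ fun i _ => U.smul_mem _ (hwU i)) z
    have ha0 : 0 ≤ a := Finset.sum_nonneg fun i _ => sq_nonneg _
    rw [hu1, abs_of_nonneg ha0] at h3
    exact le_sq_of_sq_eq_of_le_mul ha0 hu2 h3
  have h2 : ∀ g : k.Hk, ‖embed hk ν g‖ ^ 2 = ∫ z, g z ^ 2 ∂(ν : Measure Z) := by
    intro g
    rw [← real_inner_self_eq_norm_sq, inner_embed]
    refine integral_congr_ae ?_
    filter_upwards [coeFn_embed hk ν g] with z hz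
    rw [hz, pow_two]
  simp only [h2]
  rw [← integral_finsetSum _ fun i _ => (memLp_coe hk ν (w i)).integrable_sq]
  refine (integral_mono (integrable_finsetSum _ fun i _ =>
    (memLp_coe hk ν (w i)).integrable_sq) (integrable_const (r ^ 2)) h1).trans ?_
  simp

theorem sum_norm_sq_embed_le_one (N : ℕ) (w : Fin N → k.Hk) (hw : Orthonormal ℝ w) :
    ∑ i, ‖embed hk ν (w i)‖ ^ 2 ≤ 1 := by
  simpa using sum_norm_sq_embed_le hk ν (U := ⊤) (r := 1)
    (fun w _ z => by simpa using abs_apply_le hk w z) N w hw fun _ => trivial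

omit [TopologicalSpace Z] [OpensMeasurableSpace Z] in
theorem eigenvalueTail_le_of_forall_sum_Ico {k : Z → Z → ℝ} {m : ℕ} {c : ℝ}
    (h : ∀ M, ∑ i ∈ Finset.Ico m M, kernelEigenvalue k ν (i + 1) ≤ c) :
    eigenvalueTail k ν m ≤ ENNReal.ofReal c := by
  have h0 : ∀ i, 0 ≤ kernelEigenvalue k ν i := fun i => Real.sSup_nonneg fun _ h => h.1.le
  rw [eigenvalueTail, ENNReal.tsum_eq_iSup_sum]
  refine iSup_le fun s => ?_
  rw [← ENNReal.ofReal_sum_of_nonneg fun (i : Set.Ioi m) _ => h0 i]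
  apply ENNReal.ofReal_le_ofReal
  obtain ⟨M, hM⟩ := (s.map (Function.Embedding.subtype _)).bddAbove
  refine le_trans ?_ (h M)
  -- The tail runs over `i > m`, whereas the finite sums index `Λ_{i+1}` with `i ≥ m`.
  rw [Finset.sum_Ico_add' (kernelEigenvalue k ν) m M 1]
  refine (Finset.sum_map s (Function.Embedding.subtype _) (kernelEigenvalue k ν)).symm.trans_le ?_
  refine Finset.sum_le_sum_of_subset_of_nonneg (fun i hi => ?_) fun i _ _ => h0 i
  have h1 := hM hi
  obtain ⟨⟨j, hj⟩, _, rfl⟩ := Finset.mem_map.mp hi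
  have h2 : m < j := hj
  simp only [Function.Embedding.subtype_apply, Finset.mem_Ico] at *
  omega

-- `V` need not be related to `ν`: a pointwise bound on `Vᗮ` can thus be obtained from one measure
-- and used for another.
include hk in
theorem eigenvalueTail_le_of_finrank_le {V : Submodule ℝ k.Hk} [FiniteDimensional ℝ V] {m : ℕ}
    (hV : Module.finrank ℝ V ≤ m) {r : ℝ} (hr : ∀ w ∈ Vᗮ, ∀ z, |w z| ≤ r * ‖w‖) :
    eigenvalueTail k ν m ≤ ENNReal.ofReal (r ^ 2) := by
  refine eigenvalueTail_le_of_forall_sum_Ico ν fun M => ?_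
  simp only [kernelEigenvalue_eq hk ν]
  exact sum_Ico_orderedEigenvalue_le (sum_norm_sq_embed_le_one hk ν) hV
    (sum_norm_sq_embed_le hk ν hr) M

include hk in
theorem eigenvalueTail_le_one (m : ℕ) : eigenvalueTail k ν m ≤ 1 := by
  simpa using eigenvalueTail_le_of_finrank_le hk ν (V := ⊥) (m := m) (r := 1) (by simp)
    fun w _ z => by simpa using abs_apply_le hk w z

theorem le_kernelEigenvalue_iff {t : ℝ} (ht : 0 < t) {i : ℕ} (hi : 1 ≤ i) :
    t ≤ kernelEigenvalue k ν i ↔ (i : Cardinal) ≤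
      Module.rank ℝ (eigenspan (embed hk ν ∘L adjoint (embed hk ν)) t) := by
  rw [kernelEigenvalue_eq hk]
  exact le_orderedEigenvalue_iff (isSymmetric_comp_adjoint _)
    (sum_inner_comp_adjoint_le (sum_norm_sq_embed_le_one hk ν)) ht hi

include hk in
theorem le_of_mem_largeIndices {n : ℕ} (hn : 0 < n) {i : ℕ} (hi : i ∈ largeIndices k n ν) :
    i ≤ n := by
  have hn' : (0 : ℝ) < n := Nat.cast_pos.mpr hn
  have h1 : 1 / (n : ℝ) ≤ kernelEigenvalue k ν i := by
    rw [div_le_iff₀ hn', mul_comm]; exact hi.2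
  have h2 := natCast_mul_le_of_le_rank_eigenspan (isSymmetric_comp_adjoint _)
    (sum_inner_comp_adjoint_le (sum_norm_sq_embed_le_one hk ν))
    ((le_kernelEigenvalue_iff hk ν (by positivity) hi.1).mp h1)
  rw [mul_one_div, div_le_one hn'] at h2
  exact_mod_cast h2

include hk in
theorem bddAbove_largeIndices {n : ℕ} (hn : 0 < n) : BddAbove (largeIndices k n ν) :=
  ⟨n, fun _ hi => le_of_mem_largeIndices hk ν hn hi⟩

include hk in
theorem effectiveIndex_le {n : ℕ} (hn : 0 < n) : effectiveIndex k n ν ≤ n :=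
  csSup_le' fun _ hi => le_of_mem_largeIndices hk ν hn hi

theorem finrank_eigenspan_le_effectiveIndex {n : ℕ} (hn : 0 < n) :
    Module.finrank ℝ (eigenspan (embed hk ν ∘L adjoint (embed hk ν)) (1 / n)) ≤
      effectiveIndex k n ν := by
  have hn' : (0 : ℝ) < n := Nat.cast_pos.mpr hn
  have := finiteDimensional_eigenspan (isSymmetric_comp_adjoint (embed hk ν))
    (sum_inner_comp_adjoint_le (sum_norm_sq_embed_le_one hk ν)) (t := 1 / (n : ℝ)) (by positivity)
  rcases Nat.eq_zero_or_pos
    (Module.finrank ℝ (eigenspan (embed hk ν ∘L adjoint (embed hk ν)) (1 / n))) with h | h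
  · rw [h]; exact Nat.zero_le _
  · refine le_csSup (bddAbove_largeIndices hk ν hn) ⟨h, ?_⟩
    have h1 := (le_kernelEigenvalue_iff hk ν (t := 1 / (n : ℝ)) (by positivity) h).mpr
      (Module.finrank_eq_rank ℝ _).le
    rwa [div_le_iff₀ hn', mul_comm] at h1

/-- Here `J g` is orthogonal to the eigenspan, so `‖J* J g‖² ≤ t ‖J g‖²`; combine with `‖J g‖² = ⟨g,
J* J g⟩ ≤ ‖g‖ ‖J* J g‖`. -/
theorem norm_sq_embed_le_of_mem_orthogonal {t : ℝ} (ht : 0 ≤ t) {g : k.Hk}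
    (hg : g ∈ ((eigenspan (embed hk ν ∘L adjoint (embed hk ν)) t).map
      (adjoint (embed hk ν) : Lp ℝ 2 (ν : Measure Z) →ₗ[ℝ] k.Hk))ᗮ) :
    ‖embed hk ν g‖ ^ 2 ≤ t * ‖g‖ ^ 2 := by
  set J := embed hk ν with hJ
  have hmem : J g ∈ (eigenspan (J ∘L adjoint J) t)ᗮ := by
    intro u hu
    rw [← adjoint_inner_left]
    exact hg _ ⟨u, hu, rfl⟩
  have h1 := inner_apply_le_of_mem_eigenspan_orthogonal
    (isCompactOperator_comp_adjoint (sum_norm_sq_embed_le_one hk ν))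
    (isSymmetric_comp_adjoint J)
    (fun f => by rw [inner_comp_adjoint_self]; positivity) ht hmem
  rw [inner_comp_adjoint_self] at h1
  have h2 : ‖J g‖ ^ 2 ≤ ‖g‖ * ‖adjoint J (J g)‖ := by
    rw [← real_inner_self_eq_norm_sq, ← adjoint_inner_right]
    exact real_inner_le_norm _ _
  rcases (sq_nonneg ‖J g‖).eq_or_lt with h0 | h0
  · rw [← h0]; positivity
  · refine le_of_mul_le_mul_right ?_ h0
    calc ‖J g‖ ^ 2 * ‖J g‖ ^ 2 ≤ (‖g‖ * ‖adjoint J (J g)‖) * (‖g‖ * ‖adjoint J (J g)‖) := by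
          gcongr
      _ = ‖g‖ ^ 2 * ‖adjoint J (J g)‖ ^ 2 := by ring
      _ ≤ ‖g‖ ^ 2 * (t * ‖J g‖ ^ 2) := by gcongr
      _ = t * ‖g‖ ^ 2 * ‖J g‖ ^ 2 := by ring

theorem eLpNorm_coe_eq (g : k.Hk) :
    eLpNorm (g : Z → ℝ) 2 (ν : Measure Z) = ENNReal.ofReal ‖embed hk ν g‖ := by
  rw [Lp.norm_def, ENNReal.ofReal_toReal (Lp.eLpNorm_ne_top _)]
  exact (eLpNorm_congr_ae (coeFn_embed hk ν g)).symm

end PDKernel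

/-! ### The perturbation response: lower bound -/

namespace PDKernel

open ContinuousLinearMap

variable {Z : Type*} [TopologicalSpace Z] {k : PDKernel Z} (hk : ∀ z, k z z ≤ 1)
  [MeasurableSpace Z] [OpensMeasurableSpace Z] (ν : ProbabilityMeasure Z)

theorem rpow_neg_half_eq_sqrt (n : ℕ) : (n : ℝ) ^ (-(1 / 2) : ℝ) = √(1 / n) := by
  rw [Real.rpow_neg n.cast_nonneg, ← Real.sqrt_eq_rpow, ← Real.sqrt_inv, one_div (n : ℝ)]

theorem enorm_apply_le_perturbationResponse {ε : ℝ} {g : k.Hk}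
    (hg : g ∈ perturbationSpace k.Hk ε ν) (z : Z) :
    ‖g z‖ₑ ≤ perturbationResponse Set.univ k.Hk ε ν := by
  have h1 : ‖g z‖ₑ ≤ piNorm Set.univ (g : Z → ℝ) := by
    -- Point evaluation is integration against a Dirac mass.
    refine le_trans (le_of_eq ?_) (le_iSup₂ (f := fun (ρ : ProbabilityMeasure Z) (_ : ρ ∈ Set.univ) =>
      ‖∫ z, g z ∂(ρ : Measure Z)‖ₑ) ⟨Measure.dirac z, inferInstance⟩ trivial)
    congr 1
    exact (integral_dirac' _ z (k.continuous_coe g).measurable.stronglyMeasurable).symm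
  exact h1.trans (le_iSup₂ (f := fun (g : k.Hk) (_ : g ∈ perturbationSpace k.Hk ε ν) =>
    piNorm Set.univ (g : Z → ℝ)) g hg)

include hk in
theorem perturbationResponse_le_of_forall_abs_le {ε D : ℝ}
    (h : ∀ g : k.Hk, ‖g‖ ≤ 1 → ‖embed hk ν g‖ ≤ ε → ∀ z, |g z| ≤ D) (hε : 0 ≤ ε) :
    perturbationResponse Set.univ k.Hk ε ν ≤ ENNReal.ofReal D := by
  refine iSup₂_le fun g hg => iSup₂_le fun ρ _ => ?_
  have h2 : ‖embed hk ν g‖ ≤ ε := by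
    have := hg.2
    rwa [eLpNorm_coe_eq hk, ENNReal.ofReal_le_ofReal_iff hε] at this
  rw [← ofReal_norm]
  apply ENNReal.ofReal_le_ofReal
  have := norm_integral_le_of_norm_le_const (μ := (ρ : Measure Z)) (f := g) (C := D)
    (Filter.Eventually.of_forall fun z => h g hg.1 h2 z)
  simpa using this

-- `V` comes from the spectrum at `ν` and the tail from an arbitrary `ρ`; the uniform bound on `Vᗮ`
-- is what transfers between them.
include hk in
theorem eigenvalueTail_le_sq_perturbationResponse {n : ℕ} (hn : 0 < n)
    (ρ : ProbabilityMeasure Z) :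
    eigenvalueTail k ρ (effectiveIndex k n ν) ≤
      perturbationResponse Set.univ k.Hk ((n : ℝ) ^ (-(1 / 2) : ℝ)) ν ^ 2 := by
  set R := perturbationResponse Set.univ k.Hk ((n : ℝ) ^ (-(1 / 2) : ℝ)) ν with hR
  by_cases hRtop : R = ⊤
  · rw [hRtop]; simp
  have hn' : (0 : ℝ) < n := Nat.cast_pos.mpr hn
  set J := embed hk ν with hJ
  have hfin : FiniteDimensional ℝ (eigenspan (J ∘L adjoint J) (1 / n)) :=
    finiteDimensional_eigenspan (isSymmetric_comp_adjoint J)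
      (sum_inner_comp_adjoint_le (sum_norm_sq_embed_le_one hk ν)) (by positivity)
  have hdim := (Submodule.finrank_map_le
    (adjoint J : Lp ℝ 2 (ν : Measure Z) →ₗ[ℝ] k.Hk) (eigenspan (J ∘L adjoint J) (1 / n))).trans
      (finrank_eigenspan_le_effectiveIndex hk ν hn)
  rw [← ENNReal.ofReal_toReal hRtop, ← ENNReal.ofReal_pow ENNReal.toReal_nonneg]
  refine eigenvalueTail_le_of_finrank_le hk ρ hdim fun w hw z => ?_
  by_cases hw0 : w = 0
  · simp [hw0]
  have hwn : 0 < ‖w‖ := norm_pos_iff.mpr hw0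
  have hmem : ‖w‖⁻¹ • w ∈ perturbationSpace k.Hk ((n : ℝ) ^ (-(1 / 2) : ℝ)) ν := by
    have h1 : ‖‖w‖⁻¹ • w‖ = 1 := by
      rw [norm_smul, norm_inv, norm_norm, inv_mul_cancel₀ hwn.ne']
    refine ⟨h1.le, ?_⟩
    rw [eLpNorm_coe_eq hk]
    apply ENNReal.ofReal_le_ofReal
    have h2 := norm_sq_embed_le_of_mem_orthogonal hk ν (t := 1 / (n : ℝ)) (by positivity)
      (Submodule.smul_mem _ ‖w‖⁻¹ hw)
    rw [h1, one_pow, mul_one] at h2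
    rw [rpow_neg_half_eq_sqrt]
    exact Real.le_sqrt_of_sq_le h2
  have h3 := enorm_apply_le_perturbationResponse ν hmem z
  rw [← hR, ← ENNReal.ofReal_toReal hRtop, ← ofReal_norm,
    ENNReal.ofReal_le_ofReal_iff ENNReal.toReal_nonneg] at h3
  rw [RKHS.coe_smul, Pi.smul_apply, norm_smul, norm_inv, norm_norm, inv_mul_le_iff₀ hwn] at h3
  rw [mul_comm]
  exact h3

include hk in
theorem half_mul_iSup_eigenvalueTail_rpow_le {n : ℕ} (hn : 0 < n) :
    (1 / 2) * (⨆ ρ : ProbabilityMeasure Z,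
        eigenvalueTail k ρ (effectiveIndex k n ν)) ^ (1 / 2 : ℝ)
      ≤ perturbationResponse Set.univ k.Hk ((n : ℝ) ^ (-(1 / 2) : ℝ)) ν := by
  have h1 := iSup_le fun ρ => eigenvalueTail_le_sq_perturbationResponse hk ν hn ρ
  have h2 := ENNReal.rpow_le_rpow h1 (by norm_num : (0 : ℝ) ≤ 1 / 2)
  rw [← ENNReal.rpow_natCast, ← ENNReal.rpow_mul] at h2
  norm_num at h2
  -- The bound holds with constant 1; the factor `1/2` is slack.
  refine le_trans (mul_le_of_le_one_left zero_le ?_) (by norm_num; exact h2)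
  norm_num

/-! ### Mercer expansion and the upper bound -/

section Mercer

variable {ν} {ψ : ℕ → Z → ℝ} (hψ : IsEigenfunctionSystem k ν ψ)

/-- The eigenfunctions as elements of `L²(ν)`. -/
noncomputable def eigenvector (i : positiveIndices k ν) : Lp ℝ 2 (ν : Measure Z) :=
  (hψ.memLp i i.2).toLp

omit [OpensMeasurableSpace Z] in
theorem coeFn_eigenvector (i : positiveIndices k ν) :
    eigenvector hψ i =ᵐ[(ν : Measure Z)] ψ i :=
  (hψ.memLp i i.2).coeFn_toLp

omit [OpensMeasurableSpace Z] in
theorem orthonormal_eigenvector : Orthonormal ℝ (eigenvector hψ) := by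
  rw [orthonormal_iff_ite]
  intro i j
  rw [L2.inner_def]
  have h := hψ.orthonormal j j.2 i i.2
  have h1 : ∫ z, inner ℝ (eigenvector hψ i z) (eigenvector hψ j z) ∂(ν : Measure Z) =
      ∫ z, ψ j z * ψ i z ∂(ν : Measure Z) := by
    refine integral_congr_ae ?_
    filter_upwards [coeFn_eigenvector hψ i, coeFn_eigenvector hψ j] with z hi hj
    rw [hi, hj]; rfl
  rw [h1, h]
  simp only [Subtype.ext_iff, eq_comm]

theorem adjoint_embed_eigenvector_apply (i : positiveIndices k ν) (z : Z) :
    adjoint (embed hk ν) (eigenvector hψ i) z = kernelEigenvalue k ν i * ψ i z := by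
  rw [adjoint_embed_apply, ← hψ.eigen i i.2 z]
  refine integral_congr_ae ?_
  filter_upwards [coeFn_eigenvector hψ i] with z' hz'
  rw [hz']

theorem embed_adjoint_eigenvector (i : positiveIndices k ν) :
    (embed hk ν ∘L adjoint (embed hk ν)) (eigenvector hψ i) =
      kernelEigenvalue k ν i • eigenvector hψ i := by
  rw [← isKernelEigenvector_iff]
  filter_upwards [coeFn_eigenvector hψ i] with z hz
  rw [hz, ← adjoint_embed_eigenvector_apply hk hψ, adjoint_embed_apply]

/-- The given system misses no eigenvector: with `N` the dimension of the eigenspan, `Λ_1, …, Λ_N ≥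
t`, and the first `N` eigenfunctions are independent inside it. -/
theorem eigenspan_le_span_eigenvector {t : ℝ} (ht : 0 < t) :
    eigenspan (embed hk ν ∘L adjoint (embed hk ν)) t ≤
      Submodule.span ℝ (Set.range (eigenvector hψ)) := by
  set T := embed hk ν ∘L adjoint (embed hk ν) with hT
  have hfin : FiniteDimensional ℝ (eigenspan T t) :=
    finiteDimensional_eigenspan (isSymmetric_comp_adjoint (embed hk ν))
      (sum_inner_comp_adjoint_le (sum_norm_sq_embed_le_one hk ν)) ht
  set N := Module.finrank ℝ (eigenspan T t) with hN
  have hΛ : ∀ i : Fin N, t ≤ kernelEigenvalue k ν (i + 1) := fun i => by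
    rw [le_kernelEigenvalue_iff hk ν ht (by omega), ← Module.finrank_eq_rank]
    exact_mod_cast Nat.succ_le_of_lt i.2
  set idx : Fin N → positiveIndices k ν := fun i => ⟨i + 1, by omega, ht.trans_le (hΛ i)⟩ with hidx
  have hinj : Function.Injective idx := fun i j h => by
    have := congrArg Subtype.val h
    simp only [hidx] at this
    exact Fin.ext (by omega)
  have hli := ((orthonormal_eigenvector hψ).comp idx hinj).linearIndependent
  have hle : Submodule.span ℝ (Set.range (eigenvector hψ ∘ idx)) ≤ eigenspan T t := by
    refine Submodule.span_le.mpr ?_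
    rintro _ ⟨i, rfl⟩
    exact Submodule.subset_span ⟨_, hΛ i, embed_adjoint_eigenvector hk hψ (idx i)⟩
  rw [← Submodule.eq_of_le_of_finrank_eq hle (by rw [finrank_span_eq_card hli, Fintype.card_fin])]
  exact Submodule.span_mono (Set.range_comp_subset_range _ _)

/-- Orthogonality to every eigenspan gives `‖J* J g‖² ≤ t ‖J g‖²` for all `t > 0`, hence `J* J g =
0`. -/
theorem embed_eq_zero_of_forall_inner_eigenvector {g : k.Hk}
    (hg : ∀ i, inner ℝ (eigenvector hψ i) (embed hk ν g) = 0) : embed hk ν g = 0 := by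
  set J := embed hk ν with hJ
  have h1 : ∀ t : ℝ, 0 < t → ‖adjoint J (J g)‖ ^ 2 ≤ t * ‖J g‖ ^ 2 := by
    intro t ht
    have hmem : J g ∈ (eigenspan (J ∘L adjoint J) t)ᗮ := by
      refine Submodule.orthogonal_le (eigenspan_le_span_eigenvector hk hψ ht) ?_
      rw [Submodule.mem_orthogonal]
      intro u hu
      induction hu using Submodule.span_induction with
      | mem u hu => obtain ⟨i, rfl⟩ := hu; exact hg i
      | zero => simp
      | add x y _ _ hx hy => rw [inner_add_left, hx, hy, add_zero]
      | smul a x _ hx => rw [real_inner_smul_left, hx, mul_zero]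
    have h2 := inner_apply_le_of_mem_eigenspan_orthogonal
      (isCompactOperator_comp_adjoint (sum_norm_sq_embed_le_one hk ν))
      (isSymmetric_comp_adjoint J)
      (fun f => by rw [inner_comp_adjoint_self]; positivity) ht.le hmem
    rwa [inner_comp_adjoint_self] at h2
  have h2 : ‖adjoint J (J g)‖ ^ 2 ≤ 0 := by
    refine le_of_forall_pos_le_add fun ε hε => ?_
    refine (h1 (ε / (‖J g‖ ^ 2 + 1)) (by positivity)).trans ?_
    rw [zero_add, div_mul_eq_mul_div, div_le_iff₀ (by positivity)]
    nlinarith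
  have h3 : adjoint J (J g) = 0 := by
    rw [← norm_eq_zero]
    exact pow_eq_zero_iff two_ne_zero |>.mp (le_antisymm h2 (sq_nonneg _))
  have h4 : inner ℝ (J g) (J g) = 0 := by
    rw [← adjoint_inner_left, h3, inner_zero_left]
  exact inner_self_eq_zero.mp h4

/-- The normalized eigenfunctions `√Λ_i ψ_i` as elements of `H_k`. -/
noncomputable def mercerVector (i : positiveIndices k ν) : k.Hk :=
  (√(kernelEigenvalue k ν i))⁻¹ • adjoint (embed hk ν) (eigenvector hψ i)

theorem mercerVector_apply (i : positiveIndices k ν) (z : Z) :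
    mercerVector hk hψ i z = √(kernelEigenvalue k ν i) * ψ i z := by
  have h0 := Real.sqrt_pos.mpr i.2.2
  rw [mercerVector, RKHS.coe_smul, Pi.smul_apply, adjoint_embed_eigenvector_apply, smul_eq_mul,
    ← mul_assoc]
  congr 1
  rw [inv_mul_eq_iff_eq_mul₀ h0.ne', Real.mul_self_sqrt i.2.2.le]

theorem inner_mercerVector_mul_sqrt (i : positiveIndices k ν) (g : k.Hk) :
    inner ℝ (mercerVector hk hψ i) g * √(kernelEigenvalue k ν i) =
      inner ℝ (eigenvector hψ i) (embed hk ν g) := by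
  have h0 := Real.sqrt_pos.mpr i.2.2
  rw [mercerVector, real_inner_smul_left, adjoint_inner_left]
  field_simp

theorem orthonormal_mercerVector : Orthonormal ℝ (mercerVector hk hψ) := by
  rw [orthonormal_iff_ite]
  intro i j
  have h0 := Real.sqrt_pos.mpr i.2.2
  rw [mercerVector, mercerVector, real_inner_smul_left, real_inner_smul_right,
    ← inner_comp_adjoint_apply, embed_adjoint_eigenvector, real_inner_smul_left,
    orthonormal_iff_ite.mp (orthonormal_eigenvector hψ)]
  split_ifs with hij
  · subst hij
    have h1 := Real.mul_self_sqrt i.2.2.le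
    rw [mul_one, ← mul_assoc, ← mul_inv, h1, inv_mul_cancel₀ i.2.2.ne']
  · simp

variable (hinj : ∀ g : k.Hk, (g : Z → ℝ) =ᵐ[(ν : Measure Z)] 0 → g = 0)

include hinj in
theorem orthogonal_span_mercerVector :
    (Submodule.span ℝ (Set.range (mercerVector hk hψ)))ᗮ = ⊥ := by
  rw [Submodule.eq_bot_iff]
  intro g hg
  apply hinj
  have h1 : embed hk ν g = 0 := embed_eq_zero_of_forall_inner_eigenvector hk hψ fun i => by
    rw [← inner_mercerVector_mul_sqrt, hg _ (Submodule.subset_span ⟨i, rfl⟩), zero_mul]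
  have h2 := coeFn_embed hk ν g
  rw [h1] at h2
  exact h2.symm.trans (Lp.coeFn_zero ℝ 2 (ν : Measure Z))

include hinj in
/-- The expansion of a function of `H_k` along the eigenfunctions. -/
theorem hasSum_mercerVector_apply (g : k.Hk) (z : Z) :
    HasSum (fun i => inner ℝ (mercerVector hk hψ i) g * mercerVector hk hψ i z) (g z) := by
  set b := HilbertBasis.mkOfOrthogonalEqBot (orthonormal_mercerVector hk hψ)
    (orthogonal_span_mercerVector hk hψ hinj) with hb
  -- Evaluation at `z` is a continuous functional, so norm convergence of the basis expansion gives
  -- convergence at every point.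
  have h1 := (b.hasSum_repr g).mapL (innerSL ℝ (k.feature z))
  rw [innerSL_apply_apply, real_inner_comm, ← apply_eq_inner] at h1
  refine (congrArg (fun f => HasSum f (g z)) (funext fun i => ?_)).mpr h1
  rw [HilbertBasis.repr_apply_apply, innerSL_apply_apply, real_inner_smul_right,
    real_inner_comm _ (k.feature z), ← apply_eq_inner, hb,
    HilbertBasis.coe_mkOfOrthogonalEqBot]

omit [TopologicalSpace Z] [OpensMeasurableSpace Z] in
theorem sum_kernelEigenvalue_le_toReal_eigenvalueTail {k : Z → Z → ℝ} {m : ℕ}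
    (htop : eigenvalueTail k ν m ≠ ⊤)
    (F : Finset (positiveIndices k ν)) (hF : ∀ i ∈ F, m < i) :
    ∑ i ∈ F, kernelEigenvalue k ν i ≤ (eigenvalueTail k ν m).toReal := by
  classical
  rw [← ENNReal.ofReal_le_iff_le_toReal htop, ENNReal.ofReal_sum_of_nonneg fun i _ => i.2.2.le,
    eigenvalueTail]
  set emb : {i // i ∈ F} → Set.Ioi m := fun i => ⟨i.1.1, hF i.1 i.2⟩ with hemb
  have hinj : Function.Injective emb := fun i j h => by
    have := congrArg Subtype.val h
    exact Subtype.ext (Subtype.ext this)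
  rw [← Finset.sum_attach]
  refine le_trans (le_of_eq ?_) (ENNReal.sum_le_tsum (F.attach.image emb))
  rw [Finset.sum_image hinj.injOn]

/-- Up to `m` the terms are `L²` coefficients of `g`: at most `m` of them, with square sum at most
`1/n`. Beyond `m`, the `H_k` coefficients have square sum at most 1 and are paired with `√Λ_i`. -/
theorem sum_abs_inner_mercerVector_mul_sqrt_le {n : ℕ} (m : ℕ) {g : k.Hk} (hg : ‖g‖ ≤ 1)
    (hg' : ‖embed hk ν g‖ ≤ √(1 / n)) (F : Finset (positiveIndices k ν)) :
    ∑ i ∈ F, |inner ℝ (mercerVector hk hψ i) g| * √(kernelEigenvalue k ν i) ≤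
      √(m / n) + √(eigenvalueTail k ν m).toReal := by
  rw [← Finset.sum_filter_add_sum_filter_not F
    (fun i : positiveIndices k ν => (i : ℕ) ≤ m)]
  refine add_le_add ?_ ?_
  · set G := F.filter (fun i : positiveIndices k ν => (i : ℕ) ≤ m) with hG
    have hcard : (G.card : ℝ) ≤ m := by
      have h1 : G.card ≤ (Finset.Icc 1 m).card :=
        Finset.card_le_card_of_injOn Subtype.val (fun i hi => by
          rw [hG] at hi
          have h2 := (Finset.mem_filter.mp hi).2
          exact Finset.mem_coe.mpr (Finset.mem_Icc.mpr ⟨i.2.1, h2⟩)) Subtype.val_injective.injOn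
      rw [Nat.card_Icc, Nat.add_sub_cancel] at h1
      exact_mod_cast h1
    have h1 := Real.sum_mul_le_sqrt_mul_sqrt G (fun _ => 1)
      (fun i => |inner ℝ (eigenvector hψ i) (embed hk ν g)|)
    simp only [one_mul, one_pow, Finset.sum_const, nsmul_eq_mul, mul_one, sq_abs] at h1
    have h2 : ∑ i ∈ G, inner ℝ (eigenvector hψ i) (embed hk ν g) ^ 2 ≤ 1 / n := by
      have h3 := (orthonormal_eigenvector hψ).sum_inner_products_le (embed hk ν g) (s := G)
      simp only [Real.norm_eq_abs, sq_abs] at h3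
      refine h3.trans ?_
      have := pow_le_pow_left₀ (norm_nonneg _) hg' 2
      rwa [Real.sq_sqrt (by positivity)] at this
    calc ∑ i ∈ G, |inner ℝ (mercerVector hk hψ i) g| * √(kernelEigenvalue k ν i)
        = ∑ i ∈ G, |inner ℝ (eigenvector hψ i) (embed hk ν g)| :=
          Finset.sum_congr rfl fun i _ => by
            rw [← inner_mercerVector_mul_sqrt hk hψ, abs_mul, abs_of_nonneg (Real.sqrt_nonneg _)]
      _ ≤ _ := h1
      _ ≤ √m * √(1 / n) :=
          mul_le_mul (Real.sqrt_le_sqrt hcard) (Real.sqrt_le_sqrt h2) (Real.sqrt_nonneg _)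
            (Real.sqrt_nonneg _)
      _ = √(m / n) := by rw [← Real.sqrt_mul m.cast_nonneg, mul_one_div]
  · set G := F.filter (fun i : positiveIndices k ν => ¬ (i : ℕ) ≤ m) with hG
    have h1 := Real.sum_mul_le_sqrt_mul_sqrt G
      (fun i => |inner ℝ (mercerVector hk hψ i) g|) (fun i => √(kernelEigenvalue k ν i))
    have h2 : ∑ i ∈ G, |inner ℝ (mercerVector hk hψ i) g| ^ 2 ≤ 1 := by
      have h3 := (orthonormal_mercerVector hk hψ).sum_inner_products_le g (s := G)
      simp only [Real.norm_eq_abs] at h3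
      exact h3.trans (pow_le_one₀ (norm_nonneg g) hg)
    have h3 : ∑ i ∈ G, √(kernelEigenvalue k ν i) ^ 2 ≤ (eigenvalueTail k ν m).toReal := by
      refine le_trans (le_of_eq (Finset.sum_congr rfl fun i _ => Real.sq_sqrt i.2.2.le)) ?_
      refine sum_kernelEigenvalue_le_toReal_eigenvalueTail
        ((eigenvalueTail_le_one hk ν m).trans_lt ENNReal.one_lt_top).ne G fun i hi => ?_
      exact not_le.mp (Finset.mem_filter.mp hi).2
    refine h1.trans ?_
    calc _ ≤ 1 * √(eigenvalueTail k ν m).toReal :=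
          mul_le_mul (Real.sqrt_le_one.mpr h2) (Real.sqrt_le_sqrt h3) (Real.sqrt_nonneg _)
            zero_le_one
      _ = _ := one_mul _

omit [TopologicalSpace Z] [OpensMeasurableSpace Z] in
theorem abs_apply_le_toReal_eigenfunctionBound {k : Z → Z → ℝ}
    (hC : eigenfunctionBound k ν ψ < ⊤)
    (i : positiveIndices k ν) (z : Z) : |ψ i z| ≤ (eigenfunctionBound k ν ψ).toReal := by
  have h1 : ‖ψ i z‖ₑ ≤ eigenfunctionBound k ν ψ :=
    (le_iSup (fun z => ‖ψ i z‖ₑ) z).trans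
      (le_iSup₂ (f := fun (j : ℕ) (_ : j ∈ positiveIndices k ν) => ⨆ z, ‖ψ j z‖ₑ) i i.2)
  have h2 := ENNReal.toReal_mono hC.ne h1
  rwa [toReal_enorm, Real.norm_eq_abs] at h2

theorem sqrt_add_sqrt_le_two_mul_sqrt_add {a b : ℝ} (ha : 0 ≤ a) (hb : 0 ≤ b) :
    √a + √b ≤ 2 * √(a + b) := by
  have h1 := Real.sqrt_le_sqrt (le_add_of_nonneg_right hb : a ≤ a + b)
  have h2 := Real.sqrt_le_sqrt (le_add_of_nonneg_left ha : b ≤ a + b)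
  linarith

include hinj hk hψ in
theorem perturbationResponse_le_of_isEigenfunctionSystem {n : ℕ} (hn : 0 < n)
    (hC : eigenfunctionBound k ν ψ < ⊤) (m : ℕ) :
    perturbationResponse Set.univ k.Hk ((n : ℝ) ^ (-(1 / 2) : ℝ)) ν
      ≤ 2 * ((m : ℝ≥0∞) / (n : ℝ≥0∞) + eigenvalueTail k ν m) ^ (1 / 2 : ℝ)
        * eigenfunctionBound k ν ψ := by
  have hn' : (0 : ℝ) < n := Nat.cast_pos.mpr hn
  set C := (eigenfunctionBound k ν ψ).toReal with hCdef
  set τ := (eigenvalueTail k ν m).toReal with hτ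
  have hτtop : eigenvalueTail k ν m ≠ ⊤ :=
    ((eigenvalueTail_le_one hk ν m).trans_lt ENNReal.one_lt_top).ne
  have hτ0 : 0 ≤ τ := ENNReal.toReal_nonneg
  have hC0 : 0 ≤ C := ENNReal.toReal_nonneg
  have h1 := perturbationResponse_le_of_forall_abs_le hk ν (ε := (n : ℝ) ^ (-(1 / 2) : ℝ))
    (D := 2 * √(m / n + τ) * C) (fun g hg hg' z => ?_) (by positivity)
  · refine h1.trans (le_of_eq ?_)
    rw [ENNReal.ofReal_mul (by positivity), ENNReal.ofReal_mul (by positivity), hCdef,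
      ENNReal.ofReal_toReal hC.ne, Real.sqrt_eq_rpow,
      ← ENNReal.ofReal_rpow_of_nonneg (by positivity) (by norm_num),
      ENNReal.ofReal_add (by positivity) hτ0, hτ, ENNReal.ofReal_toReal hτtop,
      ENNReal.ofReal_div_of_pos hn', ENNReal.ofReal_natCast, ENNReal.ofReal_natCast]
    norm_num
  · rw [rpow_neg_half_eq_sqrt] at hg'
    have hsum := hasSum_mercerVector_apply hk hψ hinj g z
    rw [← Real.norm_eq_abs]
    refine le_of_tendsto' (Filter.Tendsto.norm hsum) fun F => ?_
    have h3 := sum_abs_inner_mercerVector_mul_sqrt_le hk hψ m hg hg' F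
    calc ‖∑ i ∈ F, inner ℝ (mercerVector hk hψ i) g * mercerVector hk hψ i z‖
        ≤ ∑ i ∈ F, |inner ℝ (mercerVector hk hψ i) g| * √(kernelEigenvalue k ν i) * C := by
          refine (norm_sum_le _ _).trans (Finset.sum_le_sum fun i _ => ?_)
          rw [mercerVector_apply, Real.norm_eq_abs, abs_mul, abs_mul,
            abs_of_nonneg (Real.sqrt_nonneg _), ← mul_assoc]
          exact mul_le_mul_of_nonneg_left (abs_apply_le_toReal_eigenfunctionBound hC i z)
            (by positivity)
      _ ≤ (√(m / n) + √τ) * C := by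
          rw [← Finset.sum_mul]
          exact mul_le_mul_of_nonneg_right h3 hC0
      _ ≤ 2 * √(m / n + τ) * C :=
          mul_le_mul_of_nonneg_right
            (sqrt_add_sqrt_le_two_mul_sqrt_add (by positivity) hτ0) hC0

end Mercer

end PDKernel

theorem mainTheorem5 {p q : ℕ} (S : Set (EuclideanSpace ℝ (Fin p)))
    (A : Set (EuclideanSpace ℝ (Fin q))) (hA : IsCompact A)
    (k : PDKernel (S × A)) (hk : ∀ z, k z z ≤ 1) (n : ℕ) (hn : 0 < n) :
    -- the maximum defining `n(ν)` is over a bounded set, and `n(ν) ≤ n`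
    (∀ ν : ProbabilityMeasure (S × A),
      BddAbove (largeIndices k n ν) ∧ effectiveIndex k n ν ≤ n) ∧
    (∀ ν : ProbabilityMeasure (S × A),
      (1 / 2) * (⨆ ρ : ProbabilityMeasure (S × A),
          eigenvalueTail k ρ (effectiveIndex k n ν)) ^ (1 / 2 : ℝ)
        ≤ perturbationResponse Set.univ k.Hk ((n : ℝ) ^ (-(1 / 2) : ℝ)) ν) ∧
    ((1 / 2) * (⨆ ρ : ProbabilityMeasure (S × A), eigenvalueTail k ρ n) ^ (1 / 2 : ℝ)
      ≤ ⨅ ν : ProbabilityMeasure (S × A),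
        perturbationResponse Set.univ k.Hk ((n : ℝ) ^ (-(1 / 2) : ℝ)) ν) ∧
    (∀ ν' : ProbabilityMeasure (S × A),
      -- no non-zero function of `H_k` vanishes `ν'`-almost everywhere
      (∀ g : k.Hk, (g : S × A → ℝ) =ᵐ[(ν' : Measure (S × A))] 0 → g = 0) →
      ∀ ψ : ℕ → S × A → ℝ, IsEigenfunctionSystem k ν' ψ →
        eigenfunctionBound k ν' ψ < ⊤ →
        perturbationResponse Set.univ k.Hk ((n : ℝ) ^ (-(1 / 2) : ℝ)) ν'
          ≤ 2 * ((effectiveIndex k n ν' : ℝ≥0∞) / (n : ℝ≥0∞)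
              + eigenvalueTail k ν' (effectiveIndex k n ν')) ^ (1 / 2 : ℝ)
            * eigenfunctionBound k ν' ψ) := by
  have hhalf := fun ν : ProbabilityMeasure (S × A) =>
    PDKernel.half_mul_iSup_eigenvalueTail_rpow_le hk ν hn
  have hle := fun ν : ProbabilityMeasure (S × A) => PDKernel.effectiveIndex_le hk ν hn
  refine ⟨fun ν => ⟨PDKernel.bddAbove_largeIndices hk ν hn, hle ν⟩, hhalf,
    le_iInf fun ν => le_trans ?_ (hhalf ν), fun ν' hinj ψ hψ hC =>
      PDKernel.perturbationResponse_le_of_isEigenfunctionSystem hk hψ hinj hn hC _⟩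
  gcongr
  -- Since `n(ν) ≤ n`, the tail beyond `n` is part of the tail beyond `n(ν)`.
  exact ENNReal.tsum_mono_subtype (fun i => ENNReal.ofReal (kernelEigenvalue k _ i))
    (Set.Ioi_subset_Ioi (hle ν))
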